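/- Let $|\psi_1\rangle$ and $|\psi_2\rangle$ be two entangled (i.e. non-product) bipartite pure states (unit vectors in tensor products of two finite-dimensional complex Hilbert spaces; the local dimensions may differ). Write $|\psi\rangle\to|\phi\rangle$ if $|\psi\rangle$ can be transformed into $|\phi\rangle$ with certainty by local quantum operations and (finitely many rounds of) classical communication. For an integer $m\ge 1$ let $$f(m)=\max\{n\ge 1:\ |\psi_1\rangle^{\otimes m}\to|\psi_2\rangle^{\otimes n}\},$$ with $f(m)=0$ if this set is empty, and let $$D(\psi_1,\psi_2)=\sup_{m\ge 1}\frac{f(m)}{m}$$ be the deterministic entanglement exchange rate. For a state with Schmidt decomposition $|\psi\rangle=\sum_i\sqrt{\alpha_i}\,|e_i\rangle|f_i\rangle$ let $S^{(\tau)}(\psi)=\frac{1}{1-\tau}\log_2\sum_i\alpha_i^{\tau}$ for $\tau\in(0,\infty)\setminus\{1\}$, $S^{(0)}(\psi)=\log_2\#\{i:\alpha_i\neq 0\}$, $S^{(1)}(\psi)=-\sum_i\alpha_i\log_2\alpha_i$ and $S^{(\infty)}(\psi)=-\log_2\max_i\alpha_i$, and let $$R(\psi_1,\psi_2)=\inf_{\tau\in[0,\infty]}\frac{S^{(\tau)}(\psi_1)}{S^{(\tau)}(\psi_2)}$$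 be the entropy ratio. Then these quantities are well defined (for each $m$ the set defining $f(m)$ is finite, $D(\psi_1,\psi_2)$ is finite, $S^{(\tau)}(\psi_2)>0$ for all $\tau\in[0,\infty]$, and the ratios are bounded below), and $$0<D(\psi_1,\psi_2)\le R(\psi_1,\psi_2).$$ -/

import Mathlib

open scoped ENNReal Matrix Kronecker

noncomputable section

namespace Bipartite

/-- A pure state of a bipartite system `ℂ^A ⊗ ℂ^B` (Alice holds `ℂ^A`, Bob holds `ℂ^B`), given by
its amplitudes in the product basis `|a⟩|b⟩`. -/
structure PureState (A B : Type) [Fintype A] [Fintype B] where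
  amp : A × B → ℂ
  norm_one : ∑ p, ‖amp p‖ ^ 2 = 1

variable {A B : Type} [Fintype A] [Fintype B]

/-- A pure state is entangled if it is not a product vector. -/
def PureState.IsEntangled (ψ : PureState A B) : Prop :=
  ¬ ∃ (x : A → ℂ) (y : B → ℂ), ∀ a b, ψ.amp (a, b) = x a * y b

/-- The density matrix `|ψ⟩⟨ψ|`. -/
def PureState.density (ψ : PureState A B) : Matrix (A × B) (A × B) ℂ :=
  Matrix.vecMulVec ψ.amp (star ψ.amp)

theorem sum_tensorPow_amp (ψ : PureState A B) (m : ℕ) :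
    ∑ p : (Fin m → A) × (Fin m → B), ‖∏ k, ψ.amp (p.1 k, p.2 k)‖ ^ 2 = 1 := by
  have h : ∑ q : Fin m → A × B, ‖∏ k, ψ.amp (q k)‖ ^ 2 = 1 := by
    simp_rw [norm_prod, ← Finset.prod_pow]
    rw [← Fintype.piFinset_univ,
      ← Finset.prod_univ_sum (fun _ : Fin m => (Finset.univ : Finset (A × B)))
        (fun _ p => ‖ψ.amp p‖ ^ 2)]
    simp [ψ.norm_one]
  rw [← h]
  exact (Equiv.sum_comp (Equiv.arrowProdEquivProdArrow (Fin m) (fun _ => A) (fun _ => B))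
    (fun p => ‖∏ k, ψ.amp (p.1 k, p.2 k)‖ ^ 2)).symm

/-- The `m`-fold tensor power `|ψ⟩^{⊗m}`, as a bipartite state: Alice holds her `m` subsystems
(with basis `Fin m → A`) and Bob holds his. -/
def PureState.tensorPow (ψ : PureState A B) (m : ℕ) : PureState (Fin m → A) (Fin m → B) where
  amp p := ∏ k, ψ.amp (p.1 k, p.2 k)
  norm_one := sum_tensorPow_amp ψ m

/-- The maps on (density) matrices that are implemented by local operations and classical
communication with finitely many rounds, with output system `ℂ^A' ⊗ ℂ^B'`. Such a protocol either
stops, or starts with a local generalized measurement by one party, with Kraus operators `K i`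
(`∑ i, (K i)† K i = 1`, the dimension of the output of outcome `i` being arbitrary), whose outcome
`i` is announced and determines the protocol that is followed from then on. At the end all
classical information is discarded, that is, the outputs of all branches are summed. -/
inductive IsLOCC {A' B' : Type} : ∀ {A B : Type},
    (Matrix (A × B) (A × B) ℂ → Matrix (A' × B') (A' × B') ℂ) → Prop
  | done : IsLOCC (A := A') (B := B') (fun ρ => ρ)
  | alice {A B : Type} [Fintype A] [DecidableEq A] [Fintype B] [DecidableEq B]
      {n : ℕ} (C : Fin n → Type) [∀ i, Fintype (C i)]
      (K : ∀ i, Matrix (C i) A ℂ) (hK : ∑ i, (K i)ᴴ * K i = 1)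
      (Λ : ∀ i, Matrix (C i × B) (C i × B) ℂ → Matrix (A' × B') (A' × B') ℂ)
      (hΛ : ∀ i, IsLOCC (Λ i)) :
      IsLOCC (A := A) (B := B) (fun ρ => ∑ i, Λ i
        ((K i ⊗ₖ (1 : Matrix B B ℂ)) * ρ * (K i ⊗ₖ (1 : Matrix B B ℂ))ᴴ))
  | bob {A B : Type} [Fintype A] [DecidableEq A] [Fintype B] [DecidableEq B]
      {n : ℕ} (C : Fin n → Type) [∀ i, Fintype (C i)]
      (K : ∀ i, Matrix (C i) B ℂ) (hK : ∑ i, (K i)ᴴ * K i = 1)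
      (Λ : ∀ i, Matrix (A × C i) (A × C i) ℂ → Matrix (A' × B') (A' × B') ℂ)
      (hΛ : ∀ i, IsLOCC (Λ i)) :
      IsLOCC (A := A) (B := B) (fun ρ => ∑ i, Λ i
        (((1 : Matrix A A ℂ) ⊗ₖ K i) * ρ * ((1 : Matrix A A ℂ) ⊗ₖ K i)ᴴ))

/-- `ψ → φ`: some LOCC protocol transforms `ψ` into `φ` with certainty. -/
def PureState.Converts {A' B' : Type} [Fintype A'] [Fintype B']
    (ψ : PureState A B) (φ : PureState A' B') : Prop :=
  ∃ Λ : Matrix (A × B) (A × B) ℂ → Matrix (A' × B') (A' × B') ℂ,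
    IsLOCC Λ ∧ Λ ψ.density = φ.density

/-- The reduced density matrix `tr_B |ψ⟩⟨ψ|` of Alice. -/
def PureState.reduced (ψ : PureState A B) : Matrix A A ℂ :=
  Matrix.of fun a a' => ∑ b, ψ.density (a, b) (a', b)

theorem PureState.reduced_isHermitian (ψ : PureState A B) : ψ.reduced.IsHermitian := by
  ext a a'
  simp [PureState.reduced, PureState.density, Matrix.vecMulVec_apply, mul_comm]

/-- The Schmidt coefficients `α i` of `ψ = ∑ i, √(α i) |e_i⟩|f_i⟩`, with multiplicity and possibly
padded with zeros: the eigenvalues of the reduced density matrix. -/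
def PureState.schmidt [DecidableEq A] (ψ : PureState A B) : A → ℝ :=
  ψ.reduced_isHermitian.eigenvalues

/-- The Rényi entropy `S^{(τ)}(ψ)` of order `τ ∈ [0, ∞]`. -/
def renyiEntropy [DecidableEq A] (τ : ℝ≥0∞) (ψ : PureState A B) : ℝ :=
  if τ = ∞ then -Real.logb 2 (⨆ i, ψ.schmidt i)
  else if τ = 0 then Real.logb 2 (Nat.card {i // ψ.schmidt i ≠ 0})
  else if τ = 1 then -∑ i, ψ.schmidt i * Real.logb 2 (ψ.schmidt i)
  else 1 / (1 - τ.toReal) * Real.logb 2 (∑ i, ψ.schmidt i ^ τ.toReal)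

variable {A₁ B₁ A₂ B₂ : Type} [Fintype A₁] [Fintype B₁] [Fintype A₂] [Fintype B₂]

/-- The positive integers `n` such that `ψ₁^{⊗m} → ψ₂^{⊗n}`. -/
def obtainable (ψ₁ : PureState A₁ B₁) (ψ₂ : PureState A₂ B₂) (m : ℕ) : Set ℕ :=
  {n | 0 < n ∧ (ψ₁.tensorPow m).Converts (ψ₂.tensorPow n)}

/-- `f(m)`: the largest positive `n` such that `ψ₁^{⊗m} → ψ₂^{⊗n}`, and `0` if there is none. -/
def maxCopies (ψ₁ : PureState A₁ B₁) (ψ₂ : PureState A₂ B₂) (m : ℕ) : ℕ :=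
  sSup (obtainable ψ₁ ψ₂ m)

/-- The deterministic entanglement exchange rate `D(ψ₁, ψ₂)`. -/
def exchangeRate (ψ₁ : PureState A₁ B₁) (ψ₂ : PureState A₂ B₂) : ℝ :=
  ⨆ m : ℕ+, (maxCopies ψ₁ ψ₂ m : ℝ) / (m : ℝ)

/-- The entropy ratio `R(ψ₁, ψ₂)`. -/
def entropyRatio [DecidableEq A₁] [DecidableEq A₂]
    (ψ₁ : PureState A₁ B₁) (ψ₂ : PureState A₂ B₂) : ℝ :=
  ⨅ τ : ℝ≥0∞, renyiEntropy τ ψ₁ / renyiEntropy τ ψ₂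

end Bipartite

end

/-!
A state is identified with its matrix of amplitudes `M`, so that Alice's reduced state is `M * Mᴴ`,
a measurement by Alice replaces `M` by `K * M`, and one by Bob replaces it by `M * Kᵀ`.

**The rate is at most the entropy ratio.** If an LOCC protocol turns `M` into a pure state, then the
output of every branch is a multiple of that state, because a sum of positive semidefinite matrices
has rank one only if all summands are proportional. Going backwards through the protocol, one finds
that the Schmidt coefficients of the input are a doubly substochastic mixture of those of the output
(`IsLOCC.isMixture`): a measurement by Bob decomposes `M * Mᴴ` as a sum over the outcomes, so the
mixtures of the branches simply add up, and for a measurement by Alice the same holds for Bob's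
reduced state. The two sides are exchanged by `IsMixture.transpose`, which rests on Bessel's
inequality. This is the necessary half of Nielsen's majorization criterion. Rényi entropies are
Schur-concave (`Majorized.renyiOf_le`, from Jensen's inequality) and additive on tensor powers
(`renyiOf_productFamily`), hence `n * S(ψ₂) ≤ m * S(ψ₁)` whenever `ψ₁^{⊗m} → ψ₂^{⊗n}`.

**The rate is positive.** The largest Schmidt coefficient of `ψ₁` is less than `1`, so for large `m`
all Schmidt coefficients `α` of `ψ₁^{⊗m}` are below `1 / d`, where `d` is the dimension of Bob's
output space. Then the vector `α` is the common marginal law of the `d` values of a random injective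
map into the index set of `α`: Birkhoff's theorem provides it (`exists_random_embedding`). A
one-way protocol, in which Alice's outcome tells Bob the random injection, produces `ψ₂`
(`converts_of_lt`). Only the outcomes that matter have to be specified: an incomplete measurement can
be completed arbitrarily, since the remaining outcomes have total probability zero
(`converts_of_kraus`).
-/

namespace Bipartite

open Matrix
open scoped ComplexOrder

/-! ### Contractions and mixtures of spectra -/

section LinearAlgebra

variable {A B ι : Type*} [Fintype A] [Fintype B] [Fintype ι]

omit [Fintype A] in
theorem mul_conjTranspose_apply_self (X : Matrix A B ℂ) (a : A) :
    (X * Xᴴ) a a = ((∑ b, ‖X a b‖ ^ 2 : ℝ) : ℂ) := by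
  simp [Matrix.mul_apply, Complex.mul_conj, Complex.normSq_eq_norm_sq]

omit [Fintype B] in
theorem conjTranspose_mul_apply_self (X : Matrix A B ℂ) (b : B) :
    (Xᴴ * X) b b = ((∑ a, ‖X a b‖ ^ 2 : ℝ) : ℂ) := by
  simp [Matrix.mul_apply, Complex.conj_mul']

/-- The adjoint of a contraction is a contraction: both conditions say that the block matrix
`[1, H; Hᴴ, 1]` is positive semidefinite. -/
theorem posSemidef_one_sub_mul_conjTranspose [DecidableEq A] [DecidableEq B]
    {H : Matrix A B ℂ} (h : (1 - Hᴴ * H).PosSemidef) : (1 - H * Hᴴ).PosSemidef := by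
  have := invertibleOne (α := Matrix A A ℂ)
  have := invertibleOne (α := Matrix B B ℂ)
  have h1 := (Matrix.PosDef.fromBlocks₁₁ (A := (1 : Matrix A A ℂ)) H 1 Matrix.PosDef.one).2
    (by simpa using h)
  have h2 := (Matrix.PosDef.fromBlocks₂₂ (D := (1 : Matrix B B ℂ)) 1 H Matrix.PosDef.one).1 h1
  simpa using h2

theorem exists_unitary_diagonal [DecidableEq A] {H : Matrix A A ℂ} (hH : H.IsHermitian) :
    ∃ E : Matrix A A ℂ, Eᴴ * E = 1 ∧ E * Eᴴ = 1 ∧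
      Eᴴ * H * E = diagonal (fun a => (hH.eigenvalues a : ℂ)) := by
  have h1 : (hH.eigenvectorUnitary : Matrix A A ℂ)ᴴ * (hH.eigenvectorUnitary : Matrix A A ℂ) = 1 :=
    Unitary.coe_star_mul_self hH.eigenvectorUnitary
  have h2 : (hH.eigenvectorUnitary : Matrix A A ℂ) * (hH.eigenvectorUnitary : Matrix A A ℂ)ᴴ = 1 :=
    Unitary.coe_mul_star_self hH.eigenvectorUnitary
  refine ⟨hH.eigenvectorUnitary, h1, h2, ?_⟩
  have h3 := hH.spectral_theorem
  rw [Unitary.conjStarAlgAut_apply, Matrix.star_eq_conjTranspose] at h3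
  generalize (hH.eigenvectorUnitary : Matrix A A ℂ) = E at *
  conv_lhs => rw [h3]
  calc Eᴴ * (E * diagonal (RCLike.ofReal ∘ hH.eigenvalues) * Eᴴ) * E
      = (Eᴴ * E) * diagonal (RCLike.ofReal ∘ hH.eigenvalues) * (Eᴴ * E) := by
        simp only [Matrix.mul_assoc]
    _ = _ := by rw [h1]; simp

/-- In every orthonormal basis (the rows of a unitary `U`), the diagonal of `M * Mᴴ` is obtained
from the vector `β` by a nonnegative matrix whose row and column sums are at most `c`.
In the basis of eigenvectors this says that the spectrum of `M * Mᴴ` is weakly majorized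
by `c • β`; asking it for all bases makes the notion additive in `M * Mᴴ`. Keeping `c` inside the
matrix avoids normalizing the states, some of which may vanish. -/
def IsMixture [DecidableEq A] (M : Matrix A B ℂ) (β : ι → ℝ) (c : ℝ) : Prop :=
  ∀ U : Matrix A A ℂ, U * Uᴴ = 1 → ∃ D : A → ι → ℝ, (∀ a i, 0 ≤ D a i) ∧
    (∀ a, ∑ i, D a i ≤ c) ∧ (∀ i, ∑ a, D a i ≤ c) ∧
    ∀ a, ∑ b, ‖(U * M) a b‖ ^ 2 = ∑ i, D a i * β i

/-- Bessel's inequality for the normalized columns of `G`, which are orthogonal. A zero column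
contributes `0`, by the convention for division by `0`. -/
theorem row_sum_div_le_one [DecidableEq A] [DecidableEq B] {G : Matrix B A ℂ} {α : A → ℝ}
    (hα : ∀ a, 0 ≤ α a) (hG : Gᴴ * G = diagonal (fun a => (α a : ℂ))) (b : B) :
    ∑ a, ‖G b a‖ ^ 2 / α a ≤ 1 := by
  set T : Matrix A A ℂ := diagonal (fun a => ((1 / √(α a) : ℝ) : ℂ)) with hT
  have hTT : Tᴴ = T := by
    rw [hT, diagonal_conjTranspose]; congr 1; ext a; simp
  have h1 : (1 - (G * T)ᴴ * (G * T)).PosSemidef := by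
    have : (G * T)ᴴ * (G * T) = diagonal (fun a => ((α a / α a : ℝ) : ℂ)) := by
      rw [conjTranspose_mul, hTT]
      calc T * Gᴴ * (G * T) = T * (Gᴴ * G) * T := by simp only [Matrix.mul_assoc]
        _ = _ := by
          rw [hG, hT, diagonal_mul_diagonal, diagonal_mul_diagonal]
          congr 1; ext a
          rw [← Complex.ofReal_mul, ← Complex.ofReal_mul]
          congr 1
          have := Real.mul_self_sqrt (hα a)
          calc _ = α a / (√(α a) * √(α a)) := by ring
            _ = _ := by rw [this]
    rw [this, ← diagonal_one, diagonal_sub]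
    refine PosSemidef.diagonal fun a => ?_
    have : α a / α a ≤ 1 := div_self_le_one _
    simp only [Pi.zero_apply]
    rw [← Complex.ofReal_one, ← Complex.ofReal_sub]
    exact_mod_cast sub_nonneg.2 this
  have h2 := (posSemidef_one_sub_mul_conjTranspose h1).diag_nonneg (i := b)
  rw [Matrix.sub_apply, mul_conjTranspose_apply_self, one_apply_eq, ← Complex.ofReal_one,
    ← Complex.ofReal_sub] at h2
  have h3 := sub_nonneg.1 (Complex.zero_le_real.1 h2)
  convert h3 using 2 with a
  rw [hT, mul_diagonal, norm_mul, mul_pow, Complex.norm_real, Real.norm_eq_abs, sq_abs, div_pow,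
    one_pow, Real.sq_sqrt (hα a), mul_one_div]

/-- `IsMixture` passes from Alice's reduced state to Bob's: if `α` is the spectrum of `M * Mᴴ`, then
the diagonal of Bob's reduced state in any basis is a doubly substochastic image of `α`. -/
theorem IsMixture.transpose [DecidableEq A] [DecidableEq B] {M : Matrix A B ℂ} {β : ι → ℝ} {c : ℝ}
    (hc : 0 ≤ c) (h : IsMixture M β c) : IsMixture Mᵀ β c := by
  intro V hV
  have hV' : Vᴴ * V = 1 := mul_eq_one_comm.1 hV
  have hM : (M * Mᴴ).IsHermitian := isHermitian_mul_conjTranspose_self M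
  obtain ⟨E, hE1, hE2, hE⟩ := exists_unitary_diagonal hM
  have hαnn : ∀ a, 0 ≤ hM.eigenvalues a := (posSemidef_self_mul_conjTranspose M).eigenvalues_nonneg
  generalize hM.eigenvalues = α at hE hαnn
  obtain ⟨D, hD0, hDr, hDc, hD⟩ := h Eᴴ (by rw [conjTranspose_conjTranspose, hE1])
  have hF : (Eᴴ * M) * (Eᴴ * M)ᴴ = diagonal (fun a => (α a : ℂ)) := by
    rw [← hE, conjTranspose_mul, conjTranspose_conjTranspose]; simp only [Matrix.mul_assoc]
  have hα : ∀ a, ∑ b, ‖(Eᴴ * M) a b‖ ^ 2 = α a := by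
    intro a
    have := mul_conjTranspose_apply_self (Eᴴ * M) a
    rw [hF, diagonal_apply_eq] at this
    exact_mod_cast this.symm
  set G : Matrix B A ℂ := V * (Eᴴ * M)ᵀ with hGdef
  have hG : Gᴴ * G = diagonal (fun a => (α a : ℂ)) := by
    have h1 : Gᴴ * G = (Eᴴ * M)ᵀᴴ * (Vᴴ * V) * (Eᴴ * M)ᵀ := by
      rw [hGdef, conjTranspose_mul]; simp only [Matrix.mul_assoc]
    have h2 : (Eᴴ * M)ᵀᴴ = (Eᴴ * M)ᴴᵀ := rfl
    rw [h1, hV', Matrix.mul_one, h2, ← transpose_mul, hF, diagonal_transpose]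
  have hcol : ∀ a, ∑ b, ‖G b a‖ ^ 2 = α a := by
    intro a
    have := conjTranspose_mul_apply_self G a
    rw [hG, diagonal_apply_eq] at this
    exact_mod_cast this.symm
  have hG0 : ∀ b a, α a = 0 → ‖G b a‖ ^ 2 = 0 := by
    intro b a h0
    have := hcol a
    rw [h0, Finset.sum_eq_zero_iff_of_nonneg (fun _ _ => by positivity)] at this
    exact this b (Finset.mem_univ _)
  have hrow := row_sum_div_le_one hαnn hG
  have hVM : ∀ b, ∑ a, ‖(V * Mᵀ) b a‖ ^ 2 = ∑ a, ‖G b a‖ ^ 2 := by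
    intro b
    have h1 := mul_conjTranspose_apply_self (V * Mᵀ) b
    have h2 := mul_conjTranspose_apply_self G b
    have h3 : G * Gᴴ = (V * Mᵀ) * (V * Mᵀ)ᴴ := by
      have h4 : Eᴴᵀ * Eᴴᵀᴴ = 1 := by
        have : Eᴴᵀᴴ = Eᵀ := by ext; simp
        rw [this, ← transpose_mul, hE2, transpose_one]
      have h5 : G = V * Mᵀ * Eᴴᵀ := by rw [hGdef, transpose_mul, Matrix.mul_assoc]
      rw [h5, conjTranspose_mul (V * Mᵀ)]
      calc _ = V * Mᵀ * (Eᴴᵀ * Eᴴᵀᴴ) * (V * Mᵀ)ᴴ := by simp only [Matrix.mul_assoc]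
        _ = _ := by rw [h4, Matrix.mul_one]
    rw [h3, h1] at h2
    exact_mod_cast h2
  refine ⟨fun b i => ∑ a, ‖G b a‖ ^ 2 / α a * D a i, ?_, ?_, ?_, ?_⟩
  · intro b i
    exact Finset.sum_nonneg fun a _ =>
      mul_nonneg (div_nonneg (by positivity) (hαnn a)) (hD0 a i)
  · intro b
    rw [Finset.sum_comm]
    simp_rw [← Finset.mul_sum]
    calc ∑ a, ‖G b a‖ ^ 2 / α a * ∑ i, D a i ≤ ∑ a, ‖G b a‖ ^ 2 / α a * c :=
          Finset.sum_le_sum fun a _ => mul_le_mul_of_nonneg_left (hDr a)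
            (div_nonneg (by positivity) (hαnn a))
      _ = (∑ a, ‖G b a‖ ^ 2 / α a) * c := by rw [Finset.sum_mul]
      _ ≤ 1 * c := mul_le_mul_of_nonneg_right (hrow b) hc
      _ = c := one_mul c
  · intro i
    rw [Finset.sum_comm]
    simp_rw [← Finset.sum_mul, ← Finset.sum_div, hcol]
    refine (Finset.sum_le_sum fun a _ => ?_).trans (hDc i)
    exact mul_le_of_le_one_left (hD0 a i) (div_self_le_one _)
  · intro b
    rw [hVM]
    simp_rw [Finset.sum_mul]
    rw [Finset.sum_comm]
    refine Finset.sum_congr rfl fun a _ => ?_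
    simp_rw [mul_assoc]
    rw [← Finset.mul_sum, ← hD, hα]
    by_cases h0 : α a = 0
    · rw [h0, hG0 b a h0]; simp
    · field_simp

end LinearAlgebra

/-! ### Pure states under LOCC -/

section Locc

/-- The amplitudes of a bipartite pure state, as a matrix with rows indexed by Alice's basis. -/
def PureState.matrix {A B : Type} [Fintype A] [Fintype B] (ψ : PureState A B) : Matrix A B ℂ :=
  of fun a b => ψ.amp (a, b)

/-- The rank-one matrix `|M⟩⟨M|` of the bipartite vector with amplitude matrix `M`. -/
def pureDensity {A B : Type*} (M : Matrix A B ℂ) : Matrix (A × B) (A × B) ℂ :=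
  vecMulVec (fun p => M p.1 p.2) (star fun p => M p.1 p.2)

theorem PureState.density_eq {A B : Type} [Fintype A] [Fintype B] (ψ : PureState A B) :
    ψ.density = pureDensity ψ.matrix := rfl

theorem PureState.reduced_eq {A B : Type} [Fintype A] [Fintype B] (ψ : PureState A B) :
    ψ.reduced = ψ.matrix * ψ.matrixᴴ := by
  ext a a'
  simp [PureState.reduced, PureState.density, PureState.matrix, vecMulVec_apply, Matrix.mul_apply]

theorem pureDensity_apply {A B : Type*} (M : Matrix A B ℂ) (p q : A × B) :
    pureDensity M p q = M p.1 p.2 * star (M q.1 q.2) := rfl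

theorem alice_pureDensity {A B C : Type*} [Fintype A] [Fintype B] [DecidableEq B]
    (K : Matrix C A ℂ) (M : Matrix A B ℂ) :
    (K ⊗ₖ (1 : Matrix B B ℂ)) * pureDensity M * (K ⊗ₖ (1 : Matrix B B ℂ))ᴴ
      = pureDensity (K * M) := by
  have h : (K ⊗ₖ (1 : Matrix B B ℂ)) *ᵥ (fun p : A × B => M p.1 p.2)
      = fun p => (K * M) p.1 p.2 := by
    ext ⟨c, b⟩
    simp [mulVec, dotProduct, Fintype.sum_prod_type, Matrix.mul_apply, one_apply]
  rw [pureDensity, pureDensity, mul_vecMulVec, vecMulVec_mul, ← star_mulVec, h]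

theorem bob_pureDensity {A B C : Type*} [Fintype A] [DecidableEq A] [Fintype B]
    (K : Matrix C B ℂ) (M : Matrix A B ℂ) :
    ((1 : Matrix A A ℂ) ⊗ₖ K) * pureDensity M * ((1 : Matrix A A ℂ) ⊗ₖ K)ᴴ
      = pureDensity (M * Kᵀ) := by
  have h : ((1 : Matrix A A ℂ) ⊗ₖ K) *ᵥ (fun p : A × B => M p.1 p.2)
      = fun p => (M * Kᵀ) p.1 p.2 := by
    ext ⟨c, b⟩
    simp [mulVec, dotProduct, Fintype.sum_prod_type, Matrix.mul_apply, one_apply, mul_comm]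
  rw [pureDensity, pureDensity, mul_vecMulVec, vecMulVec_mul, ← star_mulVec, h]

theorem pureDensity_posSemidef {A B : Type*} [Finite A] [Finite B] (M : Matrix A B ℂ) :
    (pureDensity M).PosSemidef := posSemidef_vecMulVec_self_star _

theorem pureDensity_smul {A B : Type*} (c : ℂ) (M : Matrix A B ℂ) :
    pureDensity (c • M) = ((‖c‖ ^ 2 : ℝ) : ℂ) • pureDensity M := by
  ext p q
  have : (starRingEnd ℂ) c * c = ((‖c‖ ^ 2 : ℝ) : ℂ) := by rw [Complex.conj_mul']; simp
  rw [Matrix.smul_apply, pureDensity_apply, pureDensity_apply, ← this]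
  simp
  ring

theorem trace_pureDensity {A B : Type*} [Fintype A] [Fintype B] (M : Matrix A B ℂ) :
    (pureDensity M).trace = (M * Mᴴ).trace := by
  simp [trace, pureDensity_apply, Fintype.sum_prod_type, Matrix.mul_apply]

/-- A positive semidefinite matrix that is dominated by a multiple of a
rank-one projection is itself a nonnegative multiple of that projection. -/
theorem exists_smul_of_add_eq_smul {n : Type*} [Fintype n] {X Y : Matrix n n ℂ}
    {v : n → ℂ} {c : ℂ} (hX : X.PosSemidef) (hY : Y.PosSemidef) (hv : star v ⬝ᵥ v = 1)
    (h : X + Y = c • vecMulVec v (star v)) :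
    ∃ r : ℝ, 0 ≤ r ∧ X = (r : ℂ) • vecMulVec v (star v) := by
  classical
  have hker : ∀ w : n → ℂ, star v ⬝ᵥ w = 0 → X *ᵥ w = 0 := by
    intro w hw
    rw [← hX.dotProduct_mulVec_zero_iff]
    have h0 : star w ⬝ᵥ (X *ᵥ w) + star w ⬝ᵥ (Y *ᵥ w) = 0 := by
      rw [← dotProduct_add, ← add_mulVec, h, smul_mulVec, vecMulVec_mulVec, hw]
      simp
    have h1 := hX.dotProduct_mulVec_nonneg w
    have h2 := hY.dotProduct_mulVec_nonneg w
    exact ((add_eq_zero_iff_of_nonneg h1 h2).1 h0).1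
  have hXv : ∀ w, X *ᵥ w = (star v ⬝ᵥ w) • (X *ᵥ v) := by
    intro w
    have := hker (w - (star v ⬝ᵥ w) • v) (by
      rw [dotProduct_sub, dotProduct_smul, hv]; simp)
    rw [mulVec_sub, mulVec_smul, sub_eq_zero] at this
    exact this
  have h1 : X = vecMulVec (X *ᵥ v) (star v) := by
    refine Matrix.ext_of_mulVec_single fun i => ?_
    rw [hXv, vecMulVec_mulVec]
    ext; simp [mul_comm]
  have h2 : X *ᵥ v = (star v ⬝ᵥ X *ᵥ v) • v := by
    have h3 : Xᴴ = X := hX.1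
    have h4 : X = vecMulVec v (star (X *ᵥ v)) := by
      conv_lhs => rw [← h3, h1]
      rw [conjTranspose_vecMulVec, star_star]
    conv_lhs => rw [h4, vecMulVec_mulVec]
    have h5 : star (X *ᵥ v) ⬝ᵥ v = star v ⬝ᵥ X *ᵥ v := by
      rw [star_mulVec, h3, dotProduct_mulVec]
    rw [h5]
    ext; simp [mul_comm]
  have h6 := hX.dotProduct_mulVec_nonneg v
  obtain ⟨r, hr, hr'⟩ := Complex.nonneg_iff.1 h6 |> fun h => (⟨(star v ⬝ᵥ X *ᵥ v).re, h.1,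
    Complex.ext rfl (by simpa using h.2.symm)⟩ : ∃ r : ℝ, 0 ≤ r ∧ star v ⬝ᵥ X *ᵥ v = r)
  refine ⟨r, hr, ?_⟩
  conv_lhs => rw [h1, h2, hr', smul_vecMulVec]

theorem IsLOCC.posSemidef {A' B' A B : Type}
    {Λ : Matrix (A × B) (A × B) ℂ → Matrix (A' × B') (A' × B') ℂ} (h : IsLOCC Λ) :
    ∀ ρ, ρ.PosSemidef → (Λ ρ).PosSemidef := by
  induction h with
  | done => exact fun ρ hρ => hρ
  | alice C K hK Λ hΛ ih =>
    exact fun ρ hρ => posSemidef_sum _ fun i _ => ih i _ (hρ.mul_mul_conjTranspose_same _)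
  | bob C K hK Λ hΛ ih =>
    exact fun ρ hρ => posSemidef_sum _ fun i _ => ih i _ (hρ.mul_mul_conjTranspose_same _)

/-- If a sum of positive semidefinite matrices is a multiple of a pure state,
so is every summand. -/
theorem exists_smul_of_sum_eq {A' B' : Type} [Fintype A'] [Fintype B'] {n : ℕ}
    {X : Fin n → Matrix (A' × B') (A' × B') ℂ} (hX : ∀ i, (X i).PosSemidef) {c : ℝ}
    {N : Matrix A' B' ℂ} (hN : (pureDensity N).trace = 1)
    (h : ∑ i, X i = (c : ℂ) • pureDensity N) :
    ∃ r : Fin n → ℝ, (∀ i, 0 ≤ r i) ∧ (∀ i, X i = (r i : ℂ) • pureDensity N) ∧ ∑ i, r i = c := by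
  have h1 : ∀ i, ∃ r : ℝ, 0 ≤ r ∧ X i = (r : ℂ) • pureDensity N := by
    intro i
    refine exists_smul_of_add_eq_smul (Y := ∑ j ∈ Finset.univ.erase i, X j) (c := c) (hX i)
      (posSemidef_sum _ fun j _ => hX j) ?_ ?_
    · rw [← hN, pureDensity, trace_vecMulVec, dotProduct_comm]
    · rw [Finset.add_sum_erase _ _ (Finset.mem_univ i), h]; rfl
  choose r hr0 hr using h1
  refine ⟨r, hr0, hr, ?_⟩
  have h2 := congrArg Matrix.trace h
  simp_rw [hr, ← Finset.sum_smul] at h2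
  rw [trace_smul, trace_smul, hN] at h2
  simp only [smul_eq_mul, mul_one] at h2
  exact_mod_cast h2

theorem IsMixture.sum {A B ι : Type*} [Fintype A] [DecidableEq A] [Fintype B] [Fintype ι]
    {n : ℕ} {C : Fin n → Type*} [∀ i, Fintype (C i)] {M : Matrix A B ℂ}
    {M' : ∀ i, Matrix A (C i) ℂ} {β : ι → ℝ} {r : Fin n → ℝ}
    (hM : M * Mᴴ = ∑ i, M' i * (M' i)ᴴ) (h : ∀ i, IsMixture (M' i) β (r i)) :
    IsMixture M β (∑ i, r i) := by
  intro U hU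
  choose D hD0 hDr hDc hD using fun i => h i U hU
  refine ⟨fun a b => ∑ i, D i a b, fun a b => Finset.sum_nonneg fun i _ => hD0 i a b, ?_, ?_, ?_⟩
  · intro a
    rw [Finset.sum_comm]
    exact Finset.sum_le_sum fun i _ => hDr i a
  · intro b
    rw [Finset.sum_comm]
    exact Finset.sum_le_sum fun i _ => hDc i b
  · intro a
    have h1 : (U * M) * (U * M)ᴴ = ∑ i, (U * M' i) * (U * M' i)ᴴ := by
      have : ∀ {X : Type _} [Fintype X] (Y : Matrix A X ℂ),
          (U * Y) * (U * Y)ᴴ = U * (Y * Yᴴ) * Uᴴ := by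
        intro X _ Y
        rw [conjTranspose_mul]; simp only [Matrix.mul_assoc]
      rw [this, hM, Matrix.mul_sum, Matrix.sum_mul]
      refine Finset.sum_congr rfl fun i _ => ?_
      rw [conjTranspose_mul]; simp only [Matrix.mul_assoc]
    have h2 := congrFun (congrFun h1 a) a
    rw [mul_conjTranspose_apply_self, Matrix.sum_apply] at h2
    simp_rw [mul_conjTranspose_apply_self] at h2
    rw [← Complex.ofReal_sum] at h2
    rw [Complex.ofReal_injective h2]
    simp_rw [hD, Finset.sum_mul]
    exact Finset.sum_comm

theorem mul_conjTranspose_eq_of_pureDensity {A B : Type*} [Fintype B] {M N : Matrix A B ℂ}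
    {c : ℂ} (h : pureDensity M = c • pureDensity N) : M * Mᴴ = c • (N * Nᴴ) := by
  ext a a'
  have h1 : ∀ b, M a b * star (M a' b) = c * (N a b * star (N a' b)) := fun b =>
    congrFun (congrFun h (a, b)) (a', b)
  simp only [Matrix.mul_apply, conjTranspose_apply, Matrix.smul_apply, smul_eq_mul, h1,
    Finset.mul_sum]

/-- The diagonal of `E * diagonal β * Eᴴ` in any basis is the image of `β` under a unistochastic
matrix. -/
theorem isMixture_of_diagonal {A B : Type*} [Fintype A] [DecidableEq A] [Fintype B]
    {M : Matrix A B ℂ} {c : ℝ} (hc : 0 ≤ c) {E : Matrix A A ℂ} {β : A → ℝ} (hE : E * Eᴴ = 1)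
    (hM : M * Mᴴ = (c : ℂ) • (E * diagonal (fun i => (β i : ℂ)) * Eᴴ)) : IsMixture M β c := by
  intro U hU
  have h1 : (U * E) * (U * E)ᴴ = 1 := by
    rw [conjTranspose_mul, Matrix.mul_assoc, ← Matrix.mul_assoc E, hE, Matrix.one_mul, hU]
  have h2 : (U * E)ᴴ * (U * E) = 1 := mul_eq_one_comm.1 h1
  have h3 : ∀ a, ∑ i, ‖(U * E) a i‖ ^ 2 = 1 := fun a => by
    have := mul_conjTranspose_apply_self (U * E) a
    rw [h1, one_apply_eq] at this
    exact_mod_cast this.symm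
  have h4 : ∀ i, ∑ a, ‖(U * E) a i‖ ^ 2 = 1 := fun i => by
    have := conjTranspose_mul_apply_self (U * E) i
    rw [h2, one_apply_eq] at this
    exact_mod_cast this.symm
  refine ⟨fun a i => c * ‖(U * E) a i‖ ^ 2, fun a i => by positivity,
    fun a => by rw [← Finset.mul_sum, h3, mul_one], fun i => by rw [← Finset.mul_sum, h4, mul_one],
    fun a => ?_⟩
  have h5 : (U * M) * (U * M)ᴴ
      = (c : ℂ) • ((U * E) * diagonal (fun i => (β i : ℂ)) * (U * E)ᴴ) := by
    rw [conjTranspose_mul, Matrix.mul_assoc, ← Matrix.mul_assoc M, hM, conjTranspose_mul,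
      Matrix.smul_mul, Matrix.mul_smul]
    simp only [Matrix.mul_assoc]
  have h6 := congrFun (congrFun h5 a) a
  rw [mul_conjTranspose_apply_self, Matrix.smul_apply, Matrix.mul_apply] at h6
  simp only [mul_diagonal, conjTranspose_apply, smul_eq_mul, Finset.mul_sum] at h6
  apply Complex.ofReal_injective
  rw [h6, Complex.ofReal_sum]
  refine Finset.sum_congr rfl fun i _ => ?_
  push_cast
  rw [← Complex.mul_conj']
  simp only [RCLike.star_def]
  ring

theorem transpose_mul_conjTranspose {A B : Type*} [Fintype A] (X : Matrix A B ℂ) :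
    Xᵀ * Xᵀᴴ = (Xᴴ * X)ᵀ := by
  rw [transpose_mul]; rfl

/-- The majorization half of Nielsen's theorem, for unnormalized inputs: if an LOCC protocol maps
`|M⟩⟨M|` to `c |N⟩⟨N|`, then the spectrum of `M * Mᴴ` is a mixture of the spectrum `β` of
`N * Nᴴ`, with total weight `c`. -/
theorem IsLOCC.isMixture {A' B' A B : Type} {iA' : Fintype A'} {iB' : Fintype B'}
    {dA' : DecidableEq A'}
    {Λ : Matrix (A × B) (A × B) ℂ → Matrix (A' × B') (A' × B') ℂ} (h : IsLOCC Λ)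
    {N : Matrix A' B' ℂ} (hN : (pureDensity N).trace = 1) {E : Matrix A' A' ℂ} {β : A' → ℝ}
    (hE : E * Eᴴ = 1) (hNE : N * Nᴴ = E * diagonal (fun i => (β i : ℂ)) * Eᴴ) :
    ∀ {_ : Fintype A} {_ : Fintype B} {_ : DecidableEq A} (M : Matrix A B ℂ) (c : ℝ), 0 ≤ c →
      Λ (pureDensity M) = (c : ℂ) • pureDensity N → IsMixture M β c := by
  induction h with
  | done =>
    intro iA iB dA M c hc hM
    obtain rfl := Subsingleton.elim iA iA'
    obtain rfl := Subsingleton.elim iB iB'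
    obtain rfl := Subsingleton.elim dA dA'
    exact isMixture_of_diagonal hc hE (by rw [mul_conjTranspose_eq_of_pureDensity hM, hNE])
  | alice C K hK Λ hΛ ih =>
    rename_i A B fA dA fB dB n fC
    intro iA iB dA' M c hc hM
    obtain rfl := Subsingleton.elim iA fA
    obtain rfl := Subsingleton.elim iB fB
    obtain rfl := Subsingleton.elim dA dA'
    classical
    simp_rw [alice_pureDensity] at hM
    obtain ⟨r, hr0, hr, rfl⟩ := exists_smul_of_sum_eq
      (fun i => (hΛ i).posSemidef _ (pureDensity_posSemidef _)) hN hM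
    -- Alice's operation acts additively on Bob's reduced state `(Mᴴ * M)ᵀ`.
    have h1 := fun i => (ih i (K i * M) (r i) (hr0 i) (hr i)).transpose (hr0 i)
    have h2 : IsMixture Mᵀ β (∑ i, r i) := by
      refine IsMixture.sum ?_ h1
      simp_rw [transpose_mul_conjTranspose]
      rw [← transpose_sum]
      congr 1
      calc Mᴴ * M = Mᴴ * (∑ i, (K i)ᴴ * K i) * M := by rw [hK, Matrix.mul_one]
        _ = ∑ i, (K i * M)ᴴ * (K i * M) := by
          rw [Matrix.mul_sum, Matrix.sum_mul]
          exact Finset.sum_congr rfl fun i _ => by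
            rw [conjTranspose_mul]; simp only [Matrix.mul_assoc]
    simpa using h2.transpose hc
  | bob C K hK Λ hΛ ih =>
    rename_i A B fA dA fB dB n fC
    intro iA iB dA' M c hc hM
    obtain rfl := Subsingleton.elim iA fA
    obtain rfl := Subsingleton.elim iB fB
    obtain rfl := Subsingleton.elim dA dA'
    simp_rw [bob_pureDensity] at hM
    obtain ⟨r, hr0, hr, rfl⟩ := exists_smul_of_sum_eq
      (fun i => (hΛ i).posSemidef _ (pureDensity_posSemidef _)) hN hM
    refine IsMixture.sum ?_ fun i => ih i (M * (K i)ᵀ) (r i) (hr0 i) (hr i)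
    calc M * Mᴴ = M * (∑ i, (K i)ᴴ * K i)ᵀ * Mᴴ := by rw [hK, transpose_one, Matrix.mul_one]
      _ = ∑ i, M * (K i)ᵀ * (M * (K i)ᵀ)ᴴ := by
        rw [transpose_sum, Matrix.mul_sum, Matrix.sum_mul]
        exact Finset.sum_congr rfl fun i _ => by
          rw [← transpose_mul_conjTranspose, conjTranspose_mul]; simp only [Matrix.mul_assoc]

end Locc

/-! ### Rényi entropies of probability vectors -/

section Entropy

variable {ι κ : Type*} [Fintype ι] [Fintype κ]

/-- The Rényi entropy of order `τ ∈ [0, ∞]` of a probability vector. -/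
noncomputable def renyiOf (τ : ℝ≥0∞) (α : ι → ℝ) : ℝ :=
  if τ = ∞ then -Real.logb 2 (⨆ i, α i)
  else if τ = 0 then Real.logb 2 (Nat.card {i // α i ≠ 0})
  else if τ = 1 then -∑ i, α i * Real.logb 2 (α i)
  else 1 / (1 - τ.toReal) * Real.logb 2 (∑ i, α i ^ τ.toReal)

/-- The function `x ↦ x ^ 0` with `0 ^ 0 = 0`. It is concave on `[0, ∞)`, vanishes at `0`, and is
multiplicative, so the entropy of order `0` can be treated like those of order `τ < 1`. -/
noncomputable def supportIndicator (x : ℝ) : ℝ := if x = 0 then 0 else 1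

theorem natCard_support (α : ι → ℝ) :
    (Nat.card {i // α i ≠ 0} : ℝ) = ∑ i, supportIndicator (α i) := by
  classical
  simp only [supportIndicator]
  rw [Nat.card_eq_fintype_card, Fintype.card_subtype, Finset.card_filter]
  push_cast
  exact Finset.sum_congr rfl fun i _ => by by_cases h : α i = 0 <;> simp [h]

theorem concaveOn_supportIndicator : ConcaveOn ℝ (Set.Ici 0) supportIndicator := by
  refine ⟨convex_Ici 0, fun x hx y hy a b ha hb hab => ?_⟩
  simp only [supportIndicator, smul_eq_mul, Set.mem_Ici] at *
  have hax := mul_nonneg ha hx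
  have hby := mul_nonneg hb hy
  by_cases h : a * x + b * y = 0
  · have h1 : a * x = 0 := by linarith
    have h2 : b * y = 0 := by linarith
    rw [if_pos h]
    rcases mul_eq_zero.1 h1 with h1 | h1 <;> rcases mul_eq_zero.1 h2 with h2 | h2 <;> simp [h1, h2]
  · rw [if_neg h]
    have h1 : a * (if x = 0 then 0 else 1) ≤ a := mul_le_of_le_one_right ha (by split_ifs <;> simp)
    have h2 : b * (if y = 0 then 0 else 1) ≤ b := mul_le_of_le_one_right hb (by split_ifs <;> simp)
    linarith

theorem sum_neg_mul_logb (α : ι → ℝ) :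
    -∑ i, α i * Real.logb 2 (α i) = (∑ i, (α i).negMulLog) / Real.log 2 := by
  rw [Finset.sum_div, ← Finset.sum_neg_distrib]
  exact Finset.sum_congr rfl fun i _ => by rw [Real.negMulLog, Real.logb]; ring

/-- The vector `α` is the image of `β` under the doubly substochastic matrix `D`. Between probability
vectors this is majorization of `α` by `β`, up to padding with zeros. -/
structure Majorized (α : ι → ℝ) (β : κ → ℝ) (D : ι → κ → ℝ) : Prop where
  nonneg : ∀ a i, 0 ≤ D a i
  row : ∀ a, ∑ i, D a i ≤ 1
  col : ∀ i, ∑ a, D a i ≤ 1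
  eq : ∀ a, α a = ∑ i, D a i * β i

/-- Schur-concavity of `∑ f`: Jensen's inequality in each row, with the missing weight placed
at `0`. -/
theorem Majorized.sum_le {α : ι → ℝ} {β : κ → ℝ} {D : ι → κ → ℝ} (h : Majorized α β D)
    (hβ : ∀ i, 0 ≤ β i) (hαβ : ∑ a, α a = ∑ i, β i) {f : ℝ → ℝ} (hf : ConcaveOn ℝ (Set.Ici 0) f)
    (hf0 : f 0 = 0) : ∑ i, f (β i) ≤ ∑ a, f (α a) := by
  have h1 : ∀ a, ∑ i, D a i * f (β i) ≤ f (α a) := by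
    intro a
    have := hf.neg.map_add_sum_le (t := Finset.univ) (w := D a) (p := β)
      (v := 1 - ∑ i, D a i) (q := 0)
      (fun i _ => h.nonneg a i) (by ring) (fun i _ => hβ i) (by linarith [h.row a]) (by simp)
    simp only [smul_eq_mul, mul_zero, zero_add, Pi.neg_apply, hf0, neg_zero, mul_neg,
      Finset.sum_neg_distrib, neg_le_neg_iff] at this
    rwa [h.eq a]
  -- Since the total mass is preserved, a column sum is `1` wherever `β` does not vanish.
  have h2 : ∀ i, (∑ a, D a i) * β i = β i := by
    have h3 : ∑ i, (∑ a, D a i) * β i = ∑ i, β i := by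
      rw [← hαβ]
      simp_rw [h.eq, Finset.sum_mul]
      exact Finset.sum_comm
    have h4 := (Finset.sum_eq_sum_iff_of_le (s := Finset.univ)
      fun i _ => mul_le_of_le_one_left (hβ i) (h.col i)).1 h3
    exact fun i => h4 i (Finset.mem_univ i)
  calc ∑ i, f (β i) = ∑ i, (∑ a, D a i) * f (β i) := by
        refine Finset.sum_congr rfl fun i _ => ?_
        by_cases hi : β i = 0
        · rw [hi, hf0, mul_zero]
        · rw [mul_right_cancel₀ hi ((h2 i).trans (one_mul _).symm), one_mul]
    _ = ∑ a, ∑ i, D a i * f (β i) := by simp_rw [Finset.sum_mul]; exact Finset.sum_comm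
    _ ≤ ∑ a, f (α a) := Finset.sum_le_sum fun a _ => h1 a

theorem exists_pos_of_sum_eq_one {α : ι → ℝ} (h0 : ∀ i, 0 ≤ α i) (h1 : ∑ i, α i = 1) :
    ∃ i, 0 < α i := by
  by_contra! h
  have : ∑ i, α i = 0 := Finset.sum_eq_zero fun i _ => le_antisymm (h i) (h0 i)
  linarith

theorem le_iSup_of_fintype (α : ι → ℝ) (i : ι) : α i ≤ ⨆ j, α j :=
  le_ciSup (Set.finite_range α).bddAbove i

theorem iSup_pos {α : ι → ℝ} (h0 : ∀ i, 0 ≤ α i) (h1 : ∑ i, α i = 1) : 0 < ⨆ i, α i := by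
  obtain ⟨i, hi⟩ := exists_pos_of_sum_eq_one h0 h1
  exact hi.trans_le (le_iSup_of_fintype α i)

theorem sum_rpow_pos {α : ι → ℝ} (h0 : ∀ i, 0 ≤ α i) (h1 : ∑ i, α i = 1) (t : ℝ) :
    0 < ∑ i, α i ^ t := by
  obtain ⟨i, hi⟩ := exists_pos_of_sum_eq_one h0 h1
  exact Finset.sum_pos' (fun j _ => Real.rpow_nonneg (h0 j) _)
    ⟨i, Finset.mem_univ i, Real.rpow_pos_of_pos hi _⟩

theorem sum_supportIndicator_pos {α : ι → ℝ} (h0 : ∀ i, 0 ≤ α i) (h1 : ∑ i, α i = 1) :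
    0 < ∑ i, supportIndicator (α i) := by
  obtain ⟨i, hi⟩ := exists_pos_of_sum_eq_one h0 h1
  exact Finset.sum_pos' (fun j _ => by unfold supportIndicator; split_ifs <;> simp)
    ⟨i, Finset.mem_univ i, by simp [supportIndicator, hi.ne']⟩

theorem Majorized.renyiOf_le {α : ι → ℝ} {β : κ → ℝ} {D : ι → κ → ℝ} (h : Majorized α β D)
    (hα0 : ∀ i, 0 ≤ α i) (hα1 : ∑ i, α i = 1) (hβ0 : ∀ i, 0 ≤ β i) (hβ1 : ∑ i, β i = 1)
    (τ : ℝ≥0∞) : renyiOf τ β ≤ renyiOf τ α := by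
  have hαβ := hα1.trans hβ1.symm
  unfold renyiOf
  split_ifs with hi h0 h1
  · rw [neg_le_neg_iff]
    refine Real.logb_le_logb_of_le one_lt_two (iSup_pos hα0 hα1) ?_
    have : Nonempty ι := ⟨(exists_pos_of_sum_eq_one hα0 hα1).choose⟩
    refine ciSup_le fun a => ?_
    rw [h.eq a]
    calc ∑ i, D a i * β i ≤ ∑ i, D a i * ⨆ j, β j := Finset.sum_le_sum fun i _ =>
          mul_le_mul_of_nonneg_left (le_iSup_of_fintype β i) (h.nonneg a i)
      _ = (∑ i, D a i) * ⨆ j, β j := by rw [Finset.sum_mul]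
      _ ≤ ⨆ j, β j := mul_le_of_le_one_left (iSup_pos hβ0 hβ1).le (h.row a)
  · rw [natCard_support, natCard_support]
    exact Real.logb_le_logb_of_le one_lt_two (sum_supportIndicator_pos hβ0 hβ1)
      (h.sum_le hβ0 hαβ concaveOn_supportIndicator (by simp [supportIndicator]))
  · rw [sum_neg_mul_logb, sum_neg_mul_logb]
    exact div_le_div_of_nonneg_right
      (h.sum_le hβ0 hαβ Real.concaveOn_negMulLog Real.negMulLog_zero) (Real.log_pos one_lt_two).le
  · have ht0 : 0 < τ.toReal := ENNReal.toReal_pos h0 hi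
    have ht1 : τ.toReal ≠ 1 := fun h => h1 ((ENNReal.toReal_eq_one_iff τ).1 h)
    rcases lt_or_gt_of_ne ht1 with ht | ht
    · refine mul_le_mul_of_nonneg_left ?_ (one_div_nonneg.2 (by linarith))
      exact Real.logb_le_logb_of_le one_lt_two (sum_rpow_pos hβ0 hβ1 _)
        (h.sum_le hβ0 hαβ (Real.concaveOn_rpow ht0.le ht.le) (Real.zero_rpow ht0.ne'))
    · refine mul_le_mul_of_nonpos_left ?_ (one_div_nonpos.2 (by linarith))
      refine Real.logb_le_logb_of_le one_lt_two (sum_rpow_pos hα0 hα1 _) ?_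
      have := h.sum_le hβ0 hαβ (convexOn_rpow ht.le).neg (by simp [Real.zero_rpow ht0.ne'])
      simpa using this

/-- The spectrum of an `m`-fold tensor power, for a matrix with spectrum `α`. -/
def productFamily (α : ι → ℝ) (m : ℕ) : (Fin m → ι) → ℝ := fun x => ∏ k, α (x k)

theorem sum_productFamily {α : ι → ℝ} {f : ℝ → ℝ} (hf1 : f 1 = 1)
    (hf : ∀ x y, 0 ≤ x → 0 ≤ y → f (x * y) = f x * f y) (h0 : ∀ i, 0 ≤ α i) (m : ℕ) :
    ∑ x, f (productFamily α m x) = (∑ i, f (α i)) ^ m := by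
  rw [Fintype.sum_pow]
  refine Finset.sum_congr rfl fun x _ => ?_
  unfold productFamily
  induction m with
  | zero => simp [hf1]
  | succ m ih =>
    rw [Fin.prod_univ_succ, Fin.prod_univ_succ, hf _ _ (h0 _)
      (Finset.prod_nonneg fun _ _ => h0 _), ih (fun k => x k.succ) (Finset.mem_univ _)]

theorem sum_productFamily_eq_one {α : ι → ℝ} (h1 : ∑ i, α i = 1) (m : ℕ) :
    ∑ x, productFamily α m x = 1 := by
  unfold productFamily
  rw [← Fintype.sum_pow, h1, one_pow]

omit [Fintype ι] in
theorem productFamily_nonneg {α : ι → ℝ} (h0 : ∀ i, 0 ≤ α i) (m : ℕ) (x : Fin m → ι) :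
    0 ≤ productFamily α m x := Finset.prod_nonneg fun _ _ => h0 _

theorem sum_negMulLog_productFamily {α : ι → ℝ} (h1 : ∑ i, α i = 1) (m : ℕ) :
    ∑ x, (productFamily α m x).negMulLog = m * ∑ i, (α i).negMulLog := by
  induction m with
  | zero => simp [productFamily]
  | succ m ih =>
    rw [← (Fin.consEquiv fun _ : Fin (m + 1) => ι).sum_comp, Fintype.sum_prod_type]
    have : ∀ (i : ι) (x : Fin m → ι), (productFamily α (m + 1)
        ((Fin.consEquiv fun _ : Fin (m + 1) => ι) (i, x))) = α i * productFamily α m x := by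
      intro i x
      simp [productFamily, Fin.consEquiv, Fin.prod_univ_succ]
    simp_rw [this, Real.negMulLog_mul, Finset.sum_add_distrib, ← Finset.sum_mul, ← Finset.mul_sum,
      ih, sum_productFamily_eq_one h1]
    rw [← Finset.sum_mul, h1]
    push_cast
    ring

theorem iSup_productFamily [Nonempty ι] {α : ι → ℝ} (h0 : ∀ i, 0 ≤ α i) (m : ℕ) :
    ⨆ x, productFamily α m x = (⨆ i, α i) ^ m := by
  refine le_antisymm (ciSup_le fun x => ?_) ?_
  · calc productFamily α m x ≤ ∏ _k : Fin m, ⨆ i, α i :=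
          Finset.prod_le_prod (fun _ _ => h0 _) fun _ _ => le_iSup_of_fintype α _
      _ = _ := by simp
  · obtain ⟨i, hi⟩ := exists_eq_ciSup_of_finite (f := α)
    refine le_trans (le_of_eq ?_) (le_iSup_of_fintype _ fun _ => i)
    simp [productFamily, hi]

theorem renyiOf_productFamily {α : ι → ℝ} (h0 : ∀ i, 0 ≤ α i) (h1 : ∑ i, α i = 1)
    (τ : ℝ≥0∞) (m : ℕ) : renyiOf τ (productFamily α m) = m * renyiOf τ α := by
  unfold renyiOf
  split_ifs with hi hz ho
  · have : Nonempty ι := ⟨(exists_pos_of_sum_eq_one h0 h1).choose⟩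
    rw [iSup_productFamily h0, Real.logb_pow]
    ring
  · rw [natCard_support, natCard_support, sum_productFamily (by simp [supportIndicator]) _ h0,
      Real.logb_pow]
    intro x y _ _
    by_cases hx : x = 0 <;> by_cases hy : y = 0 <;> simp [supportIndicator, hx, hy]
  · rw [sum_neg_mul_logb, sum_neg_mul_logb, sum_negMulLog_productFamily h1, mul_div_assoc]
  · rw [sum_productFamily (f := fun x => x ^ τ.toReal) (by simp)
      (fun x y hx hy => Real.mul_rpow hx hy) h0, Real.logb_pow]
    ring

theorem renyiOf_pos {α : ι → ℝ} (h0 : ∀ i, 0 ≤ α i) (h1 : ∑ i, α i = 1) (hlt : ∀ i, α i < 1)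
    (τ : ℝ≥0∞) : 0 < renyiOf τ α := by
  obtain ⟨i₀, hi₀⟩ := exists_pos_of_sum_eq_one h0 h1
  unfold renyiOf
  split_ifs with hi hz ho
  · have : Nonempty ι := ⟨i₀⟩
    obtain ⟨i, hi⟩ := exists_eq_ciSup_of_finite (f := α)
    rw [neg_pos]
    exact Real.logb_neg one_lt_two (iSup_pos h0 h1) (hi ▸ hlt i)
  · rw [natCard_support]
    refine Real.logb_pos one_lt_two ?_
    rw [← h1]
    refine Finset.sum_lt_sum (fun i _ => ?_) ⟨i₀, Finset.mem_univ _, ?_⟩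
    · unfold supportIndicator
      split_ifs with h
      · exact h.le
      · exact (hlt i).le
    · simpa [supportIndicator, hi₀.ne'] using hlt i₀
  · rw [sum_neg_mul_logb]
    refine div_pos (Finset.sum_pos' (fun i _ => Real.negMulLog_nonneg (h0 i) (hlt i).le)
      ⟨i₀, Finset.mem_univ _, ?_⟩) (Real.log_pos one_lt_two)
    rw [Real.negMulLog, neg_mul, neg_pos]
    exact mul_neg_of_pos_of_neg hi₀ (Real.log_neg hi₀ (hlt i₀))
  · have ht0 : 0 < τ.toReal := ENNReal.toReal_pos hz hi
    have ht1 : τ.toReal ≠ 1 := fun h => ho ((ENNReal.toReal_eq_one_iff τ).1 h)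
    rcases lt_or_gt_of_ne ht1 with ht | ht
    · refine mul_pos (one_div_pos.2 (by linarith)) (Real.logb_pos one_lt_two ?_)
      rw [← h1]
      refine Finset.sum_lt_sum (fun i _ => ?_) ⟨i₀, Finset.mem_univ _, ?_⟩
      · rcases (h0 i).eq_or_lt with h | h
        · rw [← h, Real.zero_rpow ht0.ne']
        · exact (Real.self_le_rpow_of_le_one h.le (hlt i).le ht.le)
      · exact Real.self_lt_rpow_of_lt_one hi₀ (hlt i₀) ht
    · refine mul_pos_of_neg_of_neg (one_div_neg.2 (by linarith))
        (Real.logb_neg one_lt_two (sum_rpow_pos h0 h1 _) ?_)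
      rw [← h1]
      refine Finset.sum_lt_sum (fun i _ => ?_) ⟨i₀, Finset.mem_univ _, ?_⟩
      · exact Real.rpow_le_self_of_le_one (h0 i) (hlt i).le ht.le
      · exact Real.rpow_lt_self_of_lt_one hi₀ (hlt i₀) ht

end Entropy

/-! ### Tensor powers and Schmidt coefficients -/

section TensorPower

variable {A B C : Type*}

/-- The `m`-fold Kronecker power of a matrix. -/
def tensorPower (M : Matrix A B ℂ) (m : ℕ) : Matrix (Fin m → A) (Fin m → B) ℂ :=
  of fun x y => ∏ k, M (x k) (y k)

theorem tensorPower_mul [Fintype B] (M : Matrix A B ℂ) (N : Matrix B C ℂ) (m : ℕ) :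
    tensorPower (M * N) m = tensorPower M m * tensorPower N m := by
  classical
  ext x z
  simp only [tensorPower, of_apply, Matrix.mul_apply, ← Finset.prod_mul_distrib]
  rw [Finset.prod_univ_sum, Fintype.piFinset_univ]

theorem tensorPower_conjTranspose (M : Matrix A B ℂ) (m : ℕ) :
    tensorPower Mᴴ m = (tensorPower M m)ᴴ := by
  ext x y
  simp [tensorPower]

theorem tensorPower_diagonal [DecidableEq A] (d : A → ℂ) (m : ℕ) :
    tensorPower (diagonal d) m = diagonal fun x => ∏ k, d (x k) := by
  ext x y
  by_cases h : x = y
  · subst h; simp [tensorPower]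
  · obtain ⟨k, hk⟩ := Function.ne_iff.1 h
    rw [diagonal_apply_ne _ h]
    exact Finset.prod_eq_zero (Finset.mem_univ k) (diagonal_apply_ne _ hk)

theorem tensorPower_one [DecidableEq A] (m : ℕ) : tensorPower (1 : Matrix A A ℂ) m = 1 := by
  rw [← diagonal_one, tensorPower_diagonal]
  simp

end TensorPower

/-- The columns of the unitary `E` are eigenvectors of `M * Mᴴ`, with eigenvalues `α`. No order is
imposed on the eigenvalues, so this is stable under tensor powers. -/
def Diagonalizes {A B : Type*} [Fintype A] [Fintype B] [DecidableEq A] (E : Matrix A A ℂ)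
    (M : Matrix A B ℂ) (α : A → ℝ) : Prop :=
  E * Eᴴ = 1 ∧ Eᴴ * (M * Mᴴ) * E = diagonal fun a => (α a : ℂ)

theorem Diagonalizes.conjTranspose_mul {A B : Type*} [Fintype A] [Fintype B] [DecidableEq A]
    {E : Matrix A A ℂ} {M : Matrix A B ℂ} {α : A → ℝ} (h : Diagonalizes E M α) : Eᴴ * E = 1 :=
  mul_eq_one_comm.1 h.1

theorem Diagonalizes.eq {A B : Type*} [Fintype A] [Fintype B] [DecidableEq A]
    {E : Matrix A A ℂ} {M : Matrix A B ℂ} {α : A → ℝ} (h : Diagonalizes E M α) :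
    M * Mᴴ = E * diagonal (fun a => (α a : ℂ)) * Eᴴ := by
  rw [← h.2]
  calc M * Mᴴ = (E * Eᴴ) * (M * Mᴴ) * (E * Eᴴ) := by rw [h.1]; simp
    _ = _ := by simp only [Matrix.mul_assoc]

theorem Diagonalizes.tensorPower {A B : Type*} [Fintype A] [Fintype B] [DecidableEq A]
    {E : Matrix A A ℂ} {M : Matrix A B ℂ} {α : A → ℝ} (h : Diagonalizes E M α) (m : ℕ) :
    Diagonalizes (tensorPower E m) (tensorPower M m) (productFamily α m) := by
  constructor
  · rw [← tensorPower_conjTranspose, ← tensorPower_mul, h.1, tensorPower_one]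
  · simp only [← tensorPower_conjTranspose, ← tensorPower_mul]
    rw [h.2, tensorPower_diagonal]
    simp [productFamily]

theorem Diagonalizes.row_sum {A B : Type*} [Fintype A] [Fintype B] [DecidableEq A]
    {E : Matrix A A ℂ} {M : Matrix A B ℂ} {α : A → ℝ} (h : Diagonalizes E M α) (a : A) :
    ∑ b, ‖(Eᴴ * M) a b‖ ^ 2 = α a := by
  have h1 := mul_conjTranspose_apply_self (Eᴴ * M) a
  have h2 : (Eᴴ * M) * (Eᴴ * M)ᴴ = Eᴴ * (M * Mᴴ) * E := by
    rw [Matrix.conjTranspose_mul, conjTranspose_conjTranspose]; simp only [Matrix.mul_assoc]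
  rw [h2, h.2, diagonal_apply_eq] at h1
  exact_mod_cast h1.symm

section Schmidt

variable {A B : Type} [Fintype A] [Fintype B]

theorem PureState.exists_diagonalizes [DecidableEq A] (ψ : PureState A B) :
    ∃ E, Diagonalizes E ψ.matrix ψ.schmidt := by
  obtain ⟨E, -, h2, h3⟩ := exists_unitary_diagonal ψ.reduced_isHermitian
  refine ⟨E, h2, ?_⟩
  rw [← ψ.reduced_eq]
  exact h3

theorem PureState.trace_density (ψ : PureState A B) : (pureDensity ψ.matrix).trace = 1 := by
  rw [← Complex.ofReal_one, ← ψ.norm_one, Matrix.trace]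
  push_cast
  exact Finset.sum_congr rfl fun p _ => by
    simp [pureDensity_apply, Complex.mul_conj', PureState.matrix]

theorem PureState.schmidt_nonneg [DecidableEq A] (ψ : PureState A B) (a : A) :
    0 ≤ ψ.schmidt a := by
  obtain ⟨E, hE⟩ := ψ.exists_diagonalizes
  rw [← hE.row_sum a]
  positivity

theorem PureState.sum_schmidt [DecidableEq A] (ψ : PureState A B) : ∑ a, ψ.schmidt a = 1 := by
  have h1 := ψ.reduced_isHermitian.trace_eq_sum_eigenvalues
  have h0 : ψ.reduced.trace = 1 := by rw [ψ.reduced_eq, ← trace_pureDensity, ψ.trace_density]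
  rw [h0] at h1
  have h2 : ((∑ a, ψ.schmidt a : ℝ) : ℂ) = 1 := by
    rw [h1, Complex.ofReal_sum]; rfl
  exact_mod_cast h2

/-- If a Schmidt coefficient is `1`, then all others vanish, and the state is a product. -/
theorem PureState.IsEntangled.schmidt_lt_one [DecidableEq A] {ψ : PureState A B}
    (h : ψ.IsEntangled) (a : A) : ψ.schmidt a < 1 := by
  by_contra! ha
  refine h ?_
  obtain ⟨E, hE⟩ := ψ.exists_diagonalizes
  have h0 : ∀ a', a' ≠ a → ψ.schmidt a' = 0 := by
    have h1 := ψ.sum_schmidt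
    rw [← Finset.add_sum_erase _ _ (Finset.mem_univ a)] at h1
    have h2 : ∑ x ∈ Finset.univ.erase a, ψ.schmidt x = 0 :=
      le_antisymm (by linarith) (Finset.sum_nonneg fun _ _ => ψ.schmidt_nonneg _)
    rw [Finset.sum_eq_zero_iff_of_nonneg fun _ _ => ψ.schmidt_nonneg _] at h2
    exact fun a' ha' => h2 a' (by simp [ha'])
  have h3 : ∀ a', a' ≠ a → ∀ b, (Eᴴ * ψ.matrix) a' b = 0 := by
    intro a' ha' b
    have := hE.row_sum a'
    rw [h0 a' ha', Finset.sum_eq_zero_iff_of_nonneg fun _ _ => by positivity] at this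
    simpa using this b (Finset.mem_univ b)
  refine ⟨fun x => E x a, fun b => (Eᴴ * ψ.matrix) a b, fun x b => ?_⟩
  have h4 : ψ.matrix = E * (Eᴴ * ψ.matrix) := by
    rw [← Matrix.mul_assoc, hE.1, Matrix.one_mul]
  have h5 : ψ.amp (x, b) = (E * (Eᴴ * ψ.matrix)) x b := by rw [← h4]; rfl
  rw [h5, Matrix.mul_apply, Finset.sum_eq_single a (fun a' _ ha' => by rw [h3 a' ha', mul_zero])
    (by simp)]

theorem renyiEntropy_eq [DecidableEq A] (τ : ℝ≥0∞) (ψ : PureState A B) :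
    renyiEntropy τ ψ = renyiOf τ ψ.schmidt := rfl

theorem renyiEntropy_pos [DecidableEq A] {ψ : PureState A B} (h : ψ.IsEntangled) (τ : ℝ≥0∞) :
    0 < renyiEntropy τ ψ :=
  renyiOf_pos ψ.schmidt_nonneg ψ.sum_schmidt h.schmidt_lt_one τ

theorem PureState.Converts.exists_majorized {A' B' : Type} [Fintype A'] [Fintype B']
    [DecidableEq A] [DecidableEq A'] {ψ : PureState A B} {φ : PureState A' B'} (h : ψ.Converts φ)
    {E : Matrix A A ℂ} {α : A → ℝ} (hE : Diagonalizes E ψ.matrix α)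
    {E' : Matrix A' A' ℂ} {β : A' → ℝ} (hE' : Diagonalizes E' φ.matrix β) :
    ∃ D, Majorized α β D := by
  obtain ⟨Λ, hΛ, hψ⟩ := h
  have h1 : Λ (pureDensity ψ.matrix) = ((1 : ℝ) : ℂ) • pureDensity φ.matrix := by
    rw [← ψ.density_eq, hψ, φ.density_eq]; simp
  obtain ⟨D, hD0, hDr, hDc, hD⟩ := hΛ.isMixture φ.trace_density hE'.1 hE'.eq ψ.matrix 1
    zero_le_one h1 Eᴴ (by rw [conjTranspose_conjTranspose, hE.conjTranspose_mul])
  exact ⟨D, hD0, hDr, hDc, fun a => by rw [← hE.row_sum a, hD a]⟩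

theorem renyiEntropy_le_of_converts {A' B' : Type} [Fintype A'] [Fintype B']
    [DecidableEq A] [DecidableEq A'] {ψ : PureState A B} {φ : PureState A' B'} {m n : ℕ}
    (h : (ψ.tensorPow m).Converts (φ.tensorPow n)) (τ : ℝ≥0∞) :
    n * renyiEntropy τ φ ≤ m * renyiEntropy τ ψ := by
  obtain ⟨E, hE⟩ := ψ.exists_diagonalizes
  obtain ⟨E', hE'⟩ := φ.exists_diagonalizes
  obtain ⟨D, hD⟩ := h.exists_majorized (hE.tensorPower m) (hE'.tensorPower n)
  rw [renyiEntropy_eq, renyiEntropy_eq, ← renyiOf_productFamily ψ.schmidt_nonneg ψ.sum_schmidt,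
    ← renyiOf_productFamily φ.schmidt_nonneg φ.sum_schmidt]
  exact hD.renyiOf_le (productFamily_nonneg ψ.schmidt_nonneg m)
    (sum_productFamily_eq_one ψ.sum_schmidt m) (productFamily_nonneg φ.schmidt_nonneg n)
    (sum_productFamily_eq_one φ.sum_schmidt n) τ

end Schmidt

/-! ### A one-way protocol -/

section Protocol

theorem trace_sum_kraus {A B : Type*} [Fintype A] [DecidableEq A] [Fintype B] {n : ℕ}
    {C : Fin n → Type*} [∀ i, Fintype (C i)]
    {K : ∀ i, Matrix (C i) A ℂ} (hK : ∑ i, (K i)ᴴ * K i = 1) (M : Matrix A B ℂ) :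
    ∑ i, (K i * M * (K i * M)ᴴ).trace = (M * Mᴴ).trace := by
  have h : ∀ i, (K i * M * (K i * M)ᴴ).trace = ((K i)ᴴ * K i * (M * Mᴴ)).trace := by
    intro i
    rw [conjTranspose_mul, ← Matrix.mul_assoc, trace_mul_comm]
    simp only [Matrix.mul_assoc]
  simp_rw [h]
  rw [← trace_sum, ← Matrix.sum_mul, hK, Matrix.one_mul]

theorem trace_mul_conjTranspose_transpose {A B : Type*} [Fintype A] [Fintype B]
    (M : Matrix A B ℂ) : (Mᵀ * Mᵀᴴ).trace = (M * Mᴴ).trace := by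
  rw [transpose_mul_conjTranspose, trace_transpose, trace_mul_comm]

theorem IsLOCC.trace_pureDensity {A' B' A B : Type} {iA' : Fintype A'} {iB' : Fintype B'}
    {Λ : Matrix (A × B) (A × B) ℂ → Matrix (A' × B') (A' × B') ℂ} (h : IsLOCC Λ) :
    ∀ {_ : Fintype A} {_ : Fintype B} (M : Matrix A B ℂ),
      (Λ (pureDensity M)).trace = (M * Mᴴ).trace := by
  induction h with
  | done =>
    intro iA iB M
    obtain rfl := Subsingleton.elim iA iA'
    obtain rfl := Subsingleton.elim iB iB'
    exact Bipartite.trace_pureDensity M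
  | alice C K hK Λ hΛ ih =>
    rename_i A B fA dA fB dB n fC
    intro iA iB M
    obtain rfl := Subsingleton.elim iA fA
    obtain rfl := Subsingleton.elim iB fB
    simp_rw [alice_pureDensity]
    rw [trace_sum, ← trace_sum_kraus hK M]
    exact Finset.sum_congr rfl fun i _ => ih i _
  | bob C K hK Λ hΛ ih =>
    rename_i A B fA dA fB dB n fC
    intro iA iB M
    obtain rfl := Subsingleton.elim iA fA
    obtain rfl := Subsingleton.elim iB fB
    simp_rw [bob_pureDensity]
    rw [trace_sum, ← trace_mul_conjTranspose_transpose, ← trace_sum_kraus hK Mᵀ]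
    refine Finset.sum_congr rfl fun i _ => ?_
    rw [ih i, ← trace_mul_conjTranspose_transpose]
    simp

/-- An incomplete measurement can be completed, with rank-one Kraus operators that all map into the
same line. -/
theorem exists_kraus_completion {A C σ : Type*} [Fintype A] [DecidableEq A] [Fintype C]
    [Nonempty C] [Fintype σ] {K : σ → Matrix C A ℂ} (hK : (1 - ∑ s, (K s)ᴴ * K s).PosSemidef) :
    ∃ (k : ℕ) (R : Fin k → Matrix C A ℂ), ∑ s, (K s)ᴴ * K s + ∑ j, (R j)ᴴ * R j = 1 := by
  classical
  obtain ⟨k, v, hv⟩ := posSemidef_iff_eq_sum_vecMulVec.1 hK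
  obtain ⟨c⟩ := ‹Nonempty C›
  refine ⟨k, fun j => vecMulVec (Pi.single c 1) (star (v j)), ?_⟩
  have : ∀ j, (vecMulVec (Pi.single c 1 : C → ℂ) (star (v j)))ᴴ *
      vecMulVec (Pi.single c 1) (star (v j)) = vecMulVec (v j) (star (v j)) := by
    intro j
    rw [conjTranspose_vecMulVec, vecMulVec_mul_vecMulVec]
    simp
  simp_rw [this]
  rw [← hv]
  simp

/-- Any contraction is one outcome of some measurement by Bob, whose other outcomes add a positive
semidefinite matrix to the output. -/
theorem exists_isLOCC_bob {A B B' : Type} [Fintype A] [Fintype B] [DecidableEq B] [Fintype B']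
    [Nonempty B'] {L : Matrix B' B ℂ} (hL : (1 - Lᴴ * L).PosSemidef) :
    ∃ Λ : Matrix (A × B) (A × B) ℂ → Matrix (A × B') (A × B') ℂ, IsLOCC Λ ∧
      ∀ M : Matrix A B ℂ, (Λ (pureDensity M) - pureDensity (M * Lᵀ)).PosSemidef := by
  classical
  obtain ⟨k, R, hR⟩ := exists_kraus_completion (σ := Unit) (K := fun _ => L) (by simpa using hL)
  refine ⟨_, IsLOCC.bob (fun _ : Fin (k + 1) => B') (Fin.cons L R) ?_ (fun _ ρ => ρ)
    (fun _ => IsLOCC.done), fun M => ?_⟩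
  · rw [Fin.sum_univ_succ]
    simpa using hR
  · simp only [bob_pureDensity]
    rw [Fin.sum_univ_succ, Fin.cons_zero, add_sub_cancel_left]
    exact posSemidef_sum _ fun i _ => pureDensity_posSemidef _

variable {A B A' B' : Type} [Fintype A] [Fintype B] [Fintype A'] [Fintype B']

theorem PureState.nonempty (ψ : PureState A B) : Nonempty A ∧ Nonempty B := by
  rw [← nonempty_prod]
  by_contra h
  rw [not_nonempty_iff] at h
  simpa using ψ.norm_one

/-- A one-way protocol may be specified by Kraus operators `K s` of Alice that need not form a complete
measurement, and contractions `L s` applied by Bob, as long as the branches `s` yield the target with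
total probability `1`: the completed protocol preserves the trace, so the additional branches
contribute a positive semidefinite matrix of trace `0`. -/
theorem converts_of_kraus [DecidableEq A] [DecidableEq B] {σ : Type*} [Fintype σ]
    {ψ : PureState A B} {φ : PureState A' B'}
    {K : σ → Matrix A' A ℂ} (hK : (1 - ∑ s, (K s)ᴴ * K s).PosSemidef)
    {L : σ → Matrix B' B ℂ} (hL : ∀ s, (1 - (L s)ᴴ * L s).PosSemidef)
    {c : σ → ℂ} (h : ∀ s, K s * ψ.matrix * (L s)ᵀ = c s • φ.matrix) (hc : ∑ s, ‖c s‖ ^ 2 = 1) :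
    ψ.Converts φ := by
  have := φ.nonempty.1
  have := φ.nonempty.2
  obtain ⟨k, R, hR⟩ := exists_kraus_completion hK
  let e := Fintype.equivFin (σ ⊕ Fin k)
  let K' : σ ⊕ Fin k → Matrix A' A ℂ := Sum.elim K R
  -- After an outcome of probability zero, Bob's operation is irrelevant.
  let L' : σ ⊕ Fin k → Matrix B' B ℂ := Sum.elim L 0
  have hL' : ∀ s, (1 - (L' s)ᴴ * L' s).PosSemidef := by
    rintro (s | j)
    · exact hL s
    · simpa [L'] using PosSemidef.one
  choose Λ hΛ hΛL using fun s => exists_isLOCC_bob (A := A') (hL' s)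
  let Ω : Matrix (A × B) (A × B) ℂ → Matrix (A' × B') (A' × B') ℂ := fun ρ =>
    ∑ i, Λ (e.symm i) ((K' (e.symm i) ⊗ₖ (1 : Matrix B B ℂ)) * ρ *
      (K' (e.symm i) ⊗ₖ (1 : Matrix B B ℂ))ᴴ)
  have hΩ : IsLOCC Ω := by
    refine IsLOCC.alice (fun _ => A') (fun i => K' (e.symm i)) ?_ (fun i => Λ (e.symm i))
      (fun i => hΛ _)
    rw [e.symm.sum_comp (fun s => (K' s)ᴴ * K' s), Fintype.sum_sum_type]
    exact hR
  refine ⟨Ω, hΩ, ?_⟩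
  rw [ψ.density_eq, φ.density_eq, ← sub_eq_zero]
  have h1 : Ω (pureDensity ψ.matrix) = ∑ s, Λ s (pureDensity (K' s * ψ.matrix)) := by
    simp only [Ω, alice_pureDensity]
    exact e.symm.sum_comp (fun s => Λ s (pureDensity (K' s * ψ.matrix)))
  have h2 : pureDensity φ.matrix = ∑ s, pureDensity (K s * ψ.matrix * (L s)ᵀ) := by
    simp_rw [h, pureDensity_smul, ← Finset.sum_smul]
    rw [← Complex.ofReal_sum, hc]
    simp
  have hpos : (Ω (pureDensity ψ.matrix) - pureDensity φ.matrix).PosSemidef := by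
    rw [h1, h2, Fintype.sum_sum_type, add_sub_right_comm, ← Finset.sum_sub_distrib]
    refine (posSemidef_sum _ fun s _ => hΛL (Sum.inl s) _).add (posSemidef_sum _ fun j _ => ?_)
    exact (hΛ _).posSemidef _ (pureDensity_posSemidef _)
  rw [← hpos.trace_eq_zero_iff, trace_sub, hΩ.trace_pureDensity, φ.trace_density,
    ← trace_pureDensity, ψ.trace_density, sub_self]

/-- If no coefficient of the probability vector `α` exceeds `1 / d`, there is a random injection
`π⁻¹ ∘ ι` of a set of size `d` into the index set of `α` such that the image of each point has law
`α`. Indeed the matrix with the column `α` repeated `d` times, completed by equal columns, is doubly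
stochastic, hence by Birkhoff's theorem a mixture of permutation matrices. -/
theorem exists_random_embedding [DecidableEq A] {α : A → ℝ} (h0 : ∀ a, 0 ≤ α a)
    (h1 : ∑ a, α a = 1) (ι : B' ↪ A) (hα : ∀ a, Fintype.card B' * α a ≤ 1)
    (hcard : Fintype.card B' < Fintype.card A) :
    ∃ w : Equiv.Perm A → ℝ, (∀ π, 0 ≤ w π) ∧ ∑ π, w π = 1 ∧
      ∀ a b, ∑ π : Equiv.Perm A, w π * (if π a = ι b then 1 else 0) = α a := by
  set d : ℝ := (Fintype.card B' : ℝ) with hd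
  set N : ℝ := (Fintype.card A : ℝ) with hN
  have hdN : 0 < N - d := by
    rw [sub_pos, hd, hN]; exact_mod_cast hcard
  let S : Finset A := Finset.univ.map ι
  have hS : (S.card : ℝ) = d := by simp [S, hd]
  have hS' : ((Finset.univ.filter (· ∉ S)).card : ℝ) = N - d := by
    have := Finset.card_filter_add_card_filter_not (s := Finset.univ) (· ∈ S)
    rw [← hS, hN, ← Finset.card_univ, ← this]
    simp
  let D : Matrix A A ℝ := of fun a a' => if a' ∈ S then α a else (1 - d * α a) / (N - d)
  have hD : D ∈ doublyStochastic ℝ A := by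
    rw [mem_doublyStochastic_iff_sum]
    refine ⟨fun a a' => ?_, fun a => ?_, fun a' => ?_⟩
    · simp only [D, of_apply]
      split_ifs
      · exact h0 a
      · exact div_nonneg (by linarith [hα a]) hdN.le
    · simp only [D, of_apply]
      rw [Finset.sum_ite, Finset.sum_const, Finset.sum_const, nsmul_eq_mul, nsmul_eq_mul, hS',
        Finset.filter_univ_mem, hS, mul_div_cancel₀ _ hdN.ne']
      ring
    · simp only [D, of_apply]
      split_ifs
      · exact h1
      · rw [← Finset.sum_div, Finset.sum_sub_distrib, ← Finset.mul_sum, h1, mul_one]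
        simp only [Finset.sum_const, Finset.card_univ, nsmul_eq_mul, mul_one]
        exact div_self hdN.ne'
  obtain ⟨w, hw0, hw1, hw⟩ := exists_eq_sum_perm_of_mem_doublyStochastic hD
  refine ⟨w, hw0, hw1, fun a b => ?_⟩
  have := congrFun (congrFun hw a) (ι b)
  simp only [Matrix.sum_apply, Matrix.smul_apply, smul_eq_mul] at this
  have hb : D a (ι b) = α a := by simp [D, S]
  rw [hb] at this
  rw [← this]
  refine Finset.sum_congr rfl fun π _ => ?_
  congr 1
  simp [Equiv.Perm.permMatrix, PEquiv.toMatrix_apply]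

/-- The matrix of the injection `π⁻¹ ∘ ι`, with row `a` divided by `√(α a)`; it turns the Schmidt
vectors of the input, weighted by `√(α a)`, into normalized ones. Rows with `α a = 0` are zero. -/
noncomputable def embeddingMatrix [DecidableEq A] (α : A → ℝ) (ι : B' ↪ A) (π : Equiv.Perm A) :
    Matrix A B' ℂ :=
  of fun a b => if π a = ι b then ((1 / √(α a) : ℝ) : ℂ) else 0

omit [Fintype A] in
theorem embeddingMatrix_mul_diagonal [DecidableEq A] [DecidableEq B'] {α : A → ℝ}
    (h0 : ∀ a, 0 ≤ α a) (ι : B' ↪ A) (π : Equiv.Perm A) (β : B' → ℝ) :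
    embeddingMatrix α ι π * diagonal (fun b => (β b : ℂ)) * (embeddingMatrix α ι π)ᴴ =
      diagonal (fun a => (((∑ b, if π a = ι b then β b else 0) / α a : ℝ) : ℂ)) := by
  ext a a'
  rw [Matrix.mul_apply]
  by_cases h : a = a'
  · subst h
    rw [diagonal_apply_eq, Finset.sum_div, Complex.ofReal_sum]
    refine Finset.sum_congr rfl fun b _ => ?_
    rw [mul_diagonal, conjTranspose_apply]
    simp only [embeddingMatrix, of_apply]
    split_ifs
    · simp only [RCLike.star_def, Complex.conj_ofReal]
      norm_cast
      rw [mul_right_comm, div_mul_div_comm, Real.mul_self_sqrt (h0 a)]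
      ring
    · simp
  · rw [diagonal_apply_ne _ h]
    refine Finset.sum_eq_zero fun b _ => ?_
    rw [mul_diagonal, conjTranspose_apply]
    simp only [embeddingMatrix, of_apply]
    by_cases h1 : π a = ι b <;> by_cases h2 : π a' = ι b <;> simp [h1, h2]
    exact absurd (π.injective (h1.trans h2.symm)) h

omit [Fintype B'] in
theorem conjTranspose_embeddingMatrix_mul_diagonal [DecidableEq A] [DecidableEq B'] {α : A → ℝ}
    (h0 : ∀ a, 0 ≤ α a) (ι : B' ↪ A) (π : Equiv.Perm A) :
    (embeddingMatrix α ι π)ᴴ * diagonal (fun a => (α a : ℂ)) * embeddingMatrix α ι π =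
      diagonal (fun b => ((α (π.symm (ι b)) / α (π.symm (ι b)) : ℝ) : ℂ)) := by
  ext b b'
  rw [Matrix.mul_apply, Finset.sum_eq_single (π.symm (ι b))]
  · rw [mul_diagonal, conjTranspose_apply]
    simp only [embeddingMatrix, of_apply, Equiv.apply_symm_apply, if_true,
      EmbeddingLike.apply_eq_iff_eq]
    by_cases h : b = b'
    · subst h
      rw [diagonal_apply_eq, if_pos rfl]
      simp only [RCLike.star_def, Complex.conj_ofReal]
      norm_cast
      rw [mul_right_comm, div_mul_div_comm, Real.mul_self_sqrt (h0 _)]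
      ring
    · rw [diagonal_apply_ne _ h, if_neg h, mul_zero]
  · intro a _ ha
    rw [mul_diagonal, conjTranspose_apply]
    have : π a ≠ ι b := fun h => ha (by rw [← h, Equiv.symm_apply_apply])
    simp [embeddingMatrix, this]
  · simp

theorem posSemidef_one_sub_conj_diagonal {A : Type*} [Fintype A] [DecidableEq A]
    {E : Matrix A A ℂ} (hE : E * Eᴴ = 1) {p : A → ℝ} (hp : ∀ a, p a ≤ 1) :
    (1 - E * diagonal (fun a => (p a : ℂ)) * Eᴴ).PosSemidef := by
  have h : 1 - E * diagonal (fun a => (p a : ℂ)) * Eᴴ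
      = E * diagonal (fun a => ((1 - p a : ℝ) : ℂ)) * Eᴴ := by
    have : diagonal (fun a => ((1 - p a : ℝ) : ℂ)) = 1 - diagonal (fun a => (p a : ℂ)) := by
      rw [← diagonal_one, diagonal_sub]; simp
    rw [this, Matrix.mul_sub, Matrix.sub_mul, Matrix.mul_one, hE]
  rw [h]
  refine PosSemidef.mul_mul_conjTranspose_same (PosSemidef.diagonal fun a => ?_) E
  exact Complex.zero_le_real.2 (sub_nonneg.2 (hp a))

/-- A state whose Schmidt coefficients are all less than `1 / d` can be converted into any state for
which Bob's system has dimension `d`. -/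
theorem converts_of_lt [DecidableEq A] {ψ : PureState A B} {φ : PureState A' B'}
    {E : Matrix A A ℂ} {α : A → ℝ} (hE : Diagonalizes E ψ.matrix α)
    (h0 : ∀ a, 0 ≤ α a) (h1 : ∑ a, α a = 1) (hα : ∀ a, Fintype.card B' * α a < 1) :
    ψ.Converts φ := by
  classical
  have hcard : Fintype.card B' < Fintype.card A := by
    have := ψ.nonempty.1
    have h2 : ∑ a, (Fintype.card B' : ℝ) * α a < ∑ _a : A, (1 : ℝ) :=
      Finset.sum_lt_sum_of_nonempty Finset.univ_nonempty fun a _ => hα a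
    rw [← Finset.mul_sum, h1] at h2
    simpa using h2
  obtain ⟨ι⟩ := Function.Embedding.nonempty_of_card_le hcard.le
  obtain ⟨w, hw0, hw1, hw⟩ := exists_random_embedding h0 h1 ι (fun a => (hα a).le) hcard
  obtain ⟨Y, -, hY, hX⟩ := exists_unitary_diagonal (isHermitian_conjTranspose_mul_self φ.matrix)
  generalize (isHermitian_conjTranspose_mul_self φ.matrix).eigenvalues = β at hX
  have hβ1 : ∑ b, β b = 1 := by
    have h2 := congrArg trace hX
    rw [trace_mul_comm, ← Matrix.mul_assoc, hY, Matrix.one_mul, trace_mul_comm,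
      ← trace_pureDensity, φ.trace_density, trace_diagonal] at h2
    exact_mod_cast h2.symm
  set F := Eᴴ * ψ.matrix with hFdef
  have hF : F * Fᴴ = diagonal fun a => (α a : ℂ) := by
    rw [← hE.2, hFdef, conjTranspose_mul, conjTranspose_conjTranspose]
    simp only [Matrix.mul_assoc]
  have hX' : (φ.matrix * Y)ᴴ * (φ.matrix * Y) = diagonal fun b => (β b : ℂ) := by
    rw [← hX, conjTranspose_mul]; simp only [Matrix.mul_assoc]
  let T : Equiv.Perm A → Matrix A B' ℂ := embeddingMatrix α ι
  -- Write `φ = (φ * Y) * Yᴴ` and `ψ = E * F`, where `φ * Y` has orthogonal columns and `F` orthogonal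
  -- rows. With probability `w π`, Alice maps the Schmidt vectors selected by `π` to the columns of
  -- `φ * Y`, rescaled to the right norms, and Bob maps his corresponding ones to the rows of `Yᴴ`.
  refine converts_of_kraus (σ := Equiv.Perm A) (c := fun π => ((√(w π) : ℝ) : ℂ))
    (K := fun π => ((√(w π) : ℝ) : ℂ) • (φ.matrix * Y * (T π)ᴴ * Eᴴ))
    (L := fun π => (Fᴴ * T π * Yᴴ)ᵀ) ?_ (fun π => ?_) (fun π => ?_) ?_
  · have h2 : ∀ π, (((√(w π) : ℝ) : ℂ) • (φ.matrix * Y * (T π)ᴴ * Eᴴ))ᴴ *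
        (((√(w π) : ℝ) : ℂ) • (φ.matrix * Y * (T π)ᴴ * Eᴴ)) =
        E * diagonal (fun a => ((w π * ((∑ b, if π a = ι b then β b else 0) / α a) : ℝ) : ℂ)) *
          Eᴴ := by
      intro π
      have h3 : diagonal (fun a => ((w π * ((∑ b, if π a = ι b then β b else 0) / α a) : ℝ) : ℂ))
          = (w π : ℂ) • (T π * ((φ.matrix * Y)ᴴ * (φ.matrix * Y)) * (T π)ᴴ) := by
        rw [hX', embeddingMatrix_mul_diagonal h0, ← diagonal_smul]
        congr 1; ext a; simp
      have h4 : ((√(w π) : ℝ) : ℂ) * ((√(w π) : ℝ) : ℂ) = w π := by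
        rw [← Complex.ofReal_mul, Real.mul_self_sqrt (hw0 π)]
      rw [h3, conjTranspose_smul, Matrix.smul_mul, Matrix.mul_smul, smul_smul, Matrix.mul_smul,
        Matrix.smul_mul, RCLike.star_def, Complex.conj_ofReal, h4]
      simp only [conjTranspose_mul, conjTranspose_conjTranspose, Matrix.mul_assoc]
    simp_rw [h2]
    rw [← Matrix.sum_mul, ← Matrix.mul_sum]
    have h5 : ∑ π : Equiv.Perm A, diagonal
        (fun a => ((w π * ((∑ b, if π a = ι b then β b else 0) / α a) : ℝ) : ℂ))
        = diagonal fun a => ((α a / α a : ℝ) : ℂ) := by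
      ext a a'
      rw [Matrix.sum_apply]
      by_cases h : a = a'
      · subst h
        simp only [diagonal_apply_eq]
        rw [← Complex.ofReal_sum]
        congr 1
        simp_rw [mul_div_assoc', ← Finset.sum_div]
        congr 1
        simp_rw [Finset.mul_sum]
        rw [Finset.sum_comm]
        calc ∑ b, ∑ π : Equiv.Perm A, w π * (if π a = ι b then β b else 0)
            = ∑ b, (∑ π : Equiv.Perm A, w π * (if π a = ι b then 1 else 0)) * β b := by
              simp_rw [Finset.sum_mul]
              refine Finset.sum_congr rfl fun b _ => Finset.sum_congr rfl fun π _ => ?_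
              split_ifs <;> simp
          _ = α a := by simp_rw [hw, ← Finset.mul_sum, hβ1, mul_one]
      · simp [diagonal_apply_ne _ h]
    rw [h5]
    exact posSemidef_one_sub_conj_diagonal hE.1 fun a => div_self_le_one _
  · rw [← conjTranspose_conjTranspose (Fᴴ * T π * Yᴴ)ᵀ]
    generalize hH : (Fᴴ * T π * Yᴴ)ᵀᴴ = H
    rw [conjTranspose_conjTranspose]
    apply posSemidef_one_sub_mul_conjTranspose
    have h2 : Hᴴ * H = (Y * diagonal (fun b => ((α (π.symm (ι b)) / α (π.symm (ι b)) : ℝ) : ℂ))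
        * Yᴴ)ᵀ := by
      rw [← conjTranspose_embeddingMatrix_mul_diagonal h0 ι π, ← hF, ← hH,
        conjTranspose_conjTranspose, transpose_mul_conjTranspose]
      simp only [conjTranspose_mul, conjTranspose_conjTranspose, Matrix.mul_assoc, T]
    have h3 := (posSemidef_one_sub_conj_diagonal hY
      (p := fun b => α (π.symm (ι b)) / α (π.symm (ι b))) fun b => div_self_le_one _).transpose
    rw [h2]
    rwa [transpose_sub, transpose_one] at h3
  · -- A permutation of positive weight selects no index with `α = 0`.
    rcases (hw0 π).eq_or_lt with hπ | hπ
    · simp [← hπ]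
    have h2 : ∀ b, α (π.symm (ι b)) ≠ 0 := by
      intro b hb
      have h3 := hw (π.symm (ι b)) b
      rw [hb, Finset.sum_eq_zero_iff_of_nonneg
        fun π _ => mul_nonneg (hw0 π) (by split_ifs <;> simp)] at h3
      have := h3 π (Finset.mem_univ _)
      simp [hπ.ne'] at this
    have h3 : (T π)ᴴ * (F * Fᴴ) * T π = 1 := by
      rw [hF, conjTranspose_embeddingMatrix_mul_diagonal h0]
      simp [h2]
    rw [Matrix.smul_mul, Matrix.smul_mul, transpose_transpose]
    congr 1
    calc φ.matrix * Y * (T π)ᴴ * Eᴴ * ψ.matrix * (Fᴴ * T π * Yᴴ)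
        = φ.matrix * Y * ((T π)ᴴ * (F * Fᴴ) * T π) * Yᴴ := by
          rw [hFdef]; simp only [Matrix.mul_assoc]
      _ = φ.matrix := by rw [h3, Matrix.mul_one, Matrix.mul_assoc, hY, Matrix.mul_one]
  · rw [← hw1]
    exact Finset.sum_congr rfl fun π _ => by
      rw [Complex.norm_real, Real.norm_eq_abs, sq_abs, Real.sq_sqrt (hw0 π)]

theorem exists_tensorPow_converts [DecidableEq A] {ψ : PureState A B} (hψ : ψ.IsEntangled)
    (φ : PureState A' B') : ∃ m : ℕ+, (ψ.tensorPow m).Converts φ := by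
  have := ψ.nonempty.1
  have hB' := φ.nonempty.2
  obtain ⟨E, hE⟩ := ψ.exists_diagonalizes
  have hlt : ⨆ a, ψ.schmidt a < 1 := by
    obtain ⟨a, ha⟩ := exists_eq_ciSup_of_finite (f := ψ.schmidt)
    exact ha ▸ hψ.schmidt_lt_one a
  have hd : (0 : ℝ) < Fintype.card B' := by exact_mod_cast Fintype.card_pos
  obtain ⟨m, hm⟩ := exists_pow_lt_of_lt_one (inv_pos.2 hd) hlt
  refine ⟨⟨m, Nat.pos_of_ne_zero ?_⟩, converts_of_lt (hE.tensorPower m)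
    (productFamily_nonneg ψ.schmidt_nonneg m) (sum_productFamily_eq_one ψ.sum_schmidt m)
    fun x => ?_⟩
  · rintro rfl
    rw [pow_zero] at hm
    have := (lt_inv_comm₀ one_pos hd).1 hm
    simp at this
  · have h2 : productFamily ψ.schmidt m x < (Fintype.card B' : ℝ)⁻¹ := by
      refine lt_of_le_of_lt ?_ hm
      rw [← iSup_productFamily ψ.schmidt_nonneg m]
      exact le_iSup_of_fintype _ x
    calc _ < (Fintype.card B' : ℝ) * (Fintype.card B' : ℝ)⁻¹ := mul_lt_mul_of_pos_left h2 hd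
      _ = 1 := mul_inv_cancel₀ hd.ne'

end Protocol

end Bipartite

theorem theorem1 {A₁ B₁ A₂ B₂ : Type}
    [Fintype A₁] [DecidableEq A₁] [Fintype B₁] [Fintype A₂] [DecidableEq A₂] [Fintype B₂]
    (ψ₁ : Bipartite.PureState A₁ B₁) (ψ₂ : Bipartite.PureState A₂ B₂)
    (h₁ : ψ₁.IsEntangled) (h₂ : ψ₂.IsEntangled) :
    -- the maxima, the supremum and the infimum in the definitions exist
    (∀ m : ℕ+, (Bipartite.obtainable ψ₁ ψ₂ m).Finite) ∧
    BddAbove (Set.range fun m : ℕ+ => (Bipartite.maxCopies ψ₁ ψ₂ m : ℝ) / (m : ℝ)) ∧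
    (∀ τ : ℝ≥0∞, 0 < Bipartite.renyiEntropy τ ψ₂) ∧
    BddBelow (Set.range fun τ : ℝ≥0∞ =>
      Bipartite.renyiEntropy τ ψ₁ / Bipartite.renyiEntropy τ ψ₂) ∧
    -- the two inequalities
    0 < Bipartite.exchangeRate ψ₁ ψ₂ ∧
    Bipartite.exchangeRate ψ₁ ψ₂ ≤ Bipartite.entropyRatio ψ₁ ψ₂ := by
  have hS₁ := Bipartite.renyiEntropy_pos h₁
  have hS₂ := Bipartite.renyiEntropy_pos h₂
  have hfin : ∀ m : ℕ+, (Bipartite.obtainable ψ₁ ψ₂ m).Finite := by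
    intro m
    refine (Set.finite_Iic
      ⌊m * Bipartite.renyiEntropy 1 ψ₁ / Bipartite.renyiEntropy 1 ψ₂⌋₊).subset fun n hn => ?_
    refine Nat.le_floor ?_
    rw [le_div_iff₀ (hS₂ 1)]
    exact Bipartite.renyiEntropy_le_of_converts hn.2 1
  have hle : ∀ (m : ℕ+) (τ : ℝ≥0∞), (Bipartite.maxCopies ψ₁ ψ₂ m : ℝ) / m ≤
      Bipartite.renyiEntropy τ ψ₁ / Bipartite.renyiEntropy τ ψ₂ := by
    intro m τ
    have hm : (0 : ℝ) < m := by exact_mod_cast m.pos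
    rw [div_le_div_iff₀ hm (hS₂ τ), mul_comm (Bipartite.renyiEntropy τ ψ₁)]
    rcases (Bipartite.obtainable ψ₁ ψ₂ m).eq_empty_or_nonempty with he | hne
    · rw [Bipartite.maxCopies, he, csSup_empty]
      have := hS₁ τ
      simp only [bot_eq_zero', Nat.cast_zero, zero_mul]
      positivity
    · exact Bipartite.renyiEntropy_le_of_converts (Nat.sSup_mem hne (hfin m).bddAbove).2 τ
  have hbdd : BddAbove (Set.range fun m : ℕ+ => (Bipartite.maxCopies ψ₁ ψ₂ m : ℝ) / (m : ℝ)) :=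
    ⟨_, Set.forall_mem_range.2 fun m => hle m 1⟩
  refine ⟨hfin, hbdd, hS₂, ⟨0, Set.forall_mem_range.2 fun τ => (div_pos (hS₁ τ) (hS₂ τ)).le⟩,
    ?_, ciSup_le fun m => le_ciInf fun τ => hle m τ⟩
  obtain ⟨m, hm⟩ := Bipartite.exists_tensorPow_converts h₁ (ψ₂.tensorPow 1)
  refine lt_of_lt_of_le (div_pos ?_ ?_) (le_ciSup hbdd m)
  · have h3 : 1 ≤ Bipartite.maxCopies ψ₁ ψ₂ m := le_csSup (hfin m).bddAbove ⟨one_pos, hm⟩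
    exact_mod_cast h3
  · exact_mod_cast m.pos
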